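/- Let $d\ge 1$ be an integer and $\alpha\in(0,2)$. Let $\mu_\alpha(v)=Z_{d,\alpha}^{-1}\mathcal F^{-1}\big(e^{-|\xi|^\alpha/\alpha}\big)(v)$ on $\mathbb R^d$, where $\mathcal F g(\xi)=\int_{\mathbb R^d} e^{-iv\cdot\xi}g(v)\,dv$ and $Z_{d,\alpha}$ is chosen such that $\int_{\mathbb{R}^d}\mu_\alpha=1$; it is the equilibrium of the Lévy–Fokker–Planck operator $L_\alpha f=\nabla_v\cdot(vf)-(-\Delta_v)^{\alpha/2}f$. For measurable $f:\mathbb R^d\to\mathbb R$ let $$\mathcal S_v(f,f)=\frac{C_{d,\alpha}}2\iint_{\mathbb R^d\times\mathbb R^d}\frac{\big|(f\mu_\alpha^{-1})(v)-(f\mu_\alpha^{-1})(w)\big|^2}{|v-w|^{d+\alpha}}\,\mu_\alpha(v)\,dw\,dv\in[0,\infty],\qquad C_{d,\alpha}=\frac{2^\alpha\,\Gamma(\frac{d+\alpha}2)}{\pi^{d/2}\,|\Gamma(-\frac\alpha2)|},$$ and for $g\in L^2(\mathbb R^d)$ and $s\in(0,1)$ let $\|g\|_{\dot H^s_v}^2=\|(-\Delta)^{s/2}g\|_{L^2_v}^2\in[0,\infty]$,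 where $(-\Delta)^{s/2}$ is the Fourier multiplier with symbol $|\xi|^s$ and the value is $\infty$ if $(-\Delta)^{s/2}g\notin L^2$. Then there are constants $C_R>0$ and $C>0$, depending only on $\alpha$ and $d$, such that for every $f\in L^2_v(\mu_\alpha^{-1})$, i.e. every measurable $f$ with $\int_{\mathbb{R}^d} |f|^2\mu_\alpha^{-1}\,dv<\infty$ (in particular for every $f$ in the domain $D(L_\alpha)\subset L^2_v(\mu_\alpha^{-1})$), $$\mathcal S_v(f,f)\ \ge\ C_R^{-1}\,\big\|f\mu_\alpha^{-1/2}\big\|_{\dot H^{\alpha/2}_v}^2\;-\;C\,\big\|f\mu_\alpha^{-1/2}\big\|_{L^2_v}^2 .$$ -/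

import Mathlib

open MeasureTheory

open scoped ENNReal FourierTransform

noncomputable section

namespace LevyFokkerPlanck

/-- The velocity space `ℝ^d` with its Euclidean norm. -/
abbrev Vel (d : ℕ) : Type := EuclideanSpace ℝ (Fin d)

/-- The constant `C_{d,α} = 2^α Γ((d+α)/2) / (π^{d/2} |Γ(-α/2)|)` of the singular integral
representation of the fractional Laplacian `(-Δ)^{α/2}`. -/
def fracLapConst (d : ℕ) (α : ℝ) : ℝ :=
  (2 : ℝ) ^ α * Real.Gamma (((d : ℝ) + α) / 2) /
    (Real.pi ^ ((d : ℝ) / 2) * |Real.Gamma (-(α / 2))|)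

/-- The inverse Fourier transform in the convention `ĝ(ξ) = ∫ e^{-i v·ξ} g(v) dv`, that is
`(2π)^{-d} ∫ e^{i v·ξ} φ(ξ) dξ`. -/
def invFourier {d : ℕ} (φ : Vel d → ℂ) (v : Vel d) : ℂ :=
  (((2 * Real.pi) ^ d)⁻¹ : ℝ) *
    ∫ ξ : Vel d, Complex.exp (((inner ℝ v ξ : ℝ) : ℂ) * Complex.I) * φ ξ

/-- The function `𝓕⁻¹(e^{-|ξ|^α/α})`, which is real valued since `e^{-|ξ|^α/α}` is even. -/
def unnormalizedEquilibrium {d : ℕ} (α : ℝ) (v : Vel d) : ℝ :=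
  (invFourier (fun ξ : Vel d => ((Real.exp (-(‖ξ‖ ^ α / α)) : ℝ) : ℂ)) v).re

/-- The equilibrium `μ_α = Z⁻¹ 𝓕⁻¹(e^{-|ξ|^α/α})`, with `Z` such that `∫ μ_α = 1`. -/
def equilibrium {d : ℕ} (α : ℝ) (v : Vel d) : ℝ :=
  (∫ w : Vel d, unnormalizedEquilibrium α w)⁻¹ * unnormalizedEquilibrium α v

/-- `f ∈ L²_v(ν)`: `f` is (a.e. strongly) measurable and `|f|² ν` is integrable. -/
def MemWeightedL2 {d : ℕ} (ν : Vel d → ℝ) (f : Vel d → ℝ) : Prop :=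
  AEStronglyMeasurable f volume ∧ Integrable (fun v => |f v| ^ 2 * ν v) volume

/-- The integrand of the symmetric form `𝒮_v(f,g)`, without the factor `C_{d,α}/2`. -/
def symFormIntegrand {d : ℕ} (α : ℝ) (f g : Vel d → ℝ) (v w : Vel d) : ℝ :=
  (f v * (equilibrium α v)⁻¹ - f w * (equilibrium α w)⁻¹) *
      (g v * (equilibrium α v)⁻¹ - g w * (equilibrium α w)⁻¹) /
    ‖v - w‖ ^ ((d : ℝ) + α) * equilibrium α v

/-- The dissipation `𝒮_v(f,f)`; its integrand is nonnegative, and the integral is taken with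
values in `[0,∞]`. -/
def dissipation {d : ℕ} (α : ℝ) (f : Vel d → ℝ) : ℝ≥0∞ :=
  ENNReal.ofReal (fracLapConst d α / 2) *
    ∫⁻ v : Vel d, ∫⁻ w : Vel d, ENNReal.ofReal (symFormIntegrand α f f v w)

/-- `h = (-Δ)^r g` for `g, h ∈ L²(ℝ^d)`: the Fourier multiplier relation. The `L²` Fourier
transform used here is the one with kernel `e^{-2πi v·ξ}`, for which the symbol of `-Δ` is
`(2π|ξ|)²`. -/
def IsFracLaplacian {d : ℕ} (r : ℝ) (g h : Lp ℂ 2 (volume : Measure (Vel d))) : Prop :=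
  ∀ᵐ ξ : Vel d, (𝓕 h : Lp ℂ 2 (volume : Measure (Vel d))) ξ =
    (((2 * Real.pi * ‖ξ‖) ^ (2 * r) : ℝ) : ℂ) * (𝓕 g : Lp ℂ 2 (volume : Measure (Vel d))) ξ

/-- The squared homogeneous Sobolev norm `‖g‖²_{Ḣ^s} = ‖(-Δ)^{s/2} g‖²_{L²}` of a function `g`.
It is `∞` if `g ∉ L²` or if `(-Δ)^{s/2} g ∉ L²`; otherwise the infimum is over the single element
`h = (-Δ)^{s/2} g` of `L²`. -/
def homSobolevNormSq {d : ℕ} (s : ℝ) (g : Vel d → ℝ) : ℝ≥0∞ :=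
  ⨅ (hg : MemLp (fun v => (g v : ℂ)) 2 (volume : Measure (Vel d)))
    (h : Lp ℂ 2 (volume : Measure (Vel d)))
    (_ : IsFracLaplacian (s / 2) hg.toLp h), ‖h‖ₑ ^ 2

end LevyFokkerPlanck

end

/-!
Write `μ` for the equilibrium, `h = f / μ`, `m = √μ` and `g = f μ^{-1/2} = h m`. From
`g(v) - g(w) = (h(v) - h(w)) m(v) + h(w) (m(v) - m(w))` the Gagliardo form of `g` is at most twice
the dissipation (up to its constant) plus twice
`∫ h(w)² (∫ (m(v) - m(w))² ‖v - w‖^{-d-α} dv) dw`.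
The Gagliardo form dominates the homogeneous Sobolev norm by Plancherel's theorem
(`exists_homSobolevNormSq_le_gagliardo`), and so the inequality follows from the pointwise bound
`∫ (m(v) - m(w))² ‖v - w‖^{-d-α} dv ≤ C μ(w)` (`exists_equilibrium_bounds`): then the error term is
at most `C ∫ h² μ = C ‖g‖²`. The normalization `Z` plays no role here, apart from `0 < Z < ∞`.

The pointwise bound comes from subordination: `e^{-‖ξ‖^α / α}` is a limit of Laplace transforms
`∫ e^{-t ‖ξ‖²} η(dt)`, so that `μ` is, up to `Z`, a limit of superpositions of heat kernels. No
stable law has to be constructed: suitable `η` are compound Poisson laws with a small drift, whose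
Laplace transforms are dominated by the limit (`exists_approx_subordinator`), and the estimates
below are uniform in `η` and pass to the limit.

* Upper bound. The function `(a, b) ↦ (√a - √b)²` is convex and homogeneous, hence the energy of the
  square root of a superposition is at most the superposition of the energies
  (`ofReal_sqrt_integral_sub_sq_le`). For the heat kernel at time `t` the energy at `w` is at most
  `C (√t + ‖w‖)^{-d-α}` by scaling (`exists_sqrtEnergy_heat_le`). Since `η` has mass at most one and
  a bounded moment of order `-(d + α) / 2`, the energy of `√μ` at `w` is at most a multiple of
  `min(1, ‖w‖^{-d-α})`. No pointwise upper bound or gradient bound on `μ` is needed.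
* Lower bound. `μ(w) ≥ c r^{-d-α}` whenever `‖w‖ ≤ r` and `r` is large
  (`exists_le_unnormalizedEquilibrium`). As a function of `t / r²` the heat kernel at distance `r`
  dominates a combination of four exponentials, whose integral is known from the Laplace transform
  and is of order `r^{-α}`.
-/

open Filter Topology

namespace LevyFokkerPlanck

/-! ### Increments of square integrable functions on the Fourier side -/

section Increments

variable {E : Type*} [NormedAddCommGroup E] [InnerProductSpace ℝ E] [FiniteDimensional ℝ E]
  [MeasurableSpace E] [BorelSpace E]

/-- The square of the `L²` norm as a lower integral. -/
theorem enorm_sq_eq_lintegral (f : Lp ℂ 2 (volume : Measure E)) :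
    ‖f‖ₑ ^ 2 = ∫⁻ v, ‖f v‖ₑ ^ 2 := by
  have h := eLpNorm_nnreal_pow_eq_lintegral (f := f) (μ := (volume : Measure E)) (p := 2) (by simp)
  rw [Lp.enorm_def]
  simpa using h

theorem aestronglyMeasurable_character (a : E) :
    AEStronglyMeasurable (fun ξ : E => Complex.exp (-(2 * Real.pi * inner ℝ a ξ : ℝ) * Complex.I))
      volume := by
  apply Continuous.aestronglyMeasurable
  fun_prop

theorem memLp_top_character (a : E) :
    MemLp (fun ξ : E => Complex.exp (-(2 * Real.pi * inner ℝ a ξ : ℝ) * Complex.I)) ∞ volume := by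
  refine memLp_top_of_bound (aestronglyMeasurable_character a) 1 (.of_forall fun ξ => ?_)
  rw [Complex.norm_exp]
  simp

/-- On Schwartz functions the Fourier transform turns translations into characters. -/
theorem fourier_schwartz_translate (φ : SchwartzMap E ℂ) (a ξ : E) :
    𝓕 (φ.compSubConstCLM ℂ a) ξ =
      Complex.exp (-(2 * Real.pi * inner ℝ a ξ : ℝ) * Complex.I) * 𝓕 φ ξ := by
  rw [SchwartzMap.fourier_coe, SchwartzMap.fourier_coe, Real.fourier_eq', Real.fourier_eq',
    ← integral_const_mul]
  rw [← integral_sub_right_eq_self (fun v => _ * _) a]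
  congr 1 with v
  simp only [SchwartzMap.compSubConstCLM_apply, smul_eq_mul, ← mul_assoc, ← Complex.exp_add]
  congr 2
  rw [inner_sub_left]
  push_cast
  ring

/-- The `L²` Fourier transform turns translations into characters. -/
theorem fourier_compMeasurePreserving_sub (g : Lp ℂ 2 (volume : Measure E)) (a : E) :
    (𝓕 (Lp.compMeasurePreserving (fun v : E => v - a) (measurePreserving_sub_right volume a) g :
        Lp ℂ 2 (volume : Measure E)) : Lp ℂ 2 (volume : Measure E)) =ᵐ[volume]
      fun ξ => Complex.exp (-(2 * Real.pi * inner ℝ a ξ : ℝ) * Complex.I) *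
        (𝓕 g : Lp ℂ 2 (volume : Measure E)) ξ := by
  have key : ∀ g : Lp ℂ 2 (volume : Measure E),
      (𝓕 (Lp.compMeasurePreserving (fun v : E => v - a) (measurePreserving_sub_right volume a) g :
        Lp ℂ 2 (volume : Measure E)) : Lp ℂ 2 (volume : Measure E)) =
      ContinuousLinearMap.holder (p := ∞) (q := 2) 2 (ContinuousLinearMap.mul ℂ ℂ)
        (memLp_top_character a).toLp (𝓕 g : Lp ℂ 2 (volume : Measure E)) := by
    intro g
    refine DenseRange.induction_on
      (SchwartzMap.denseRange_toLpCLM (E := E) (F := ℂ) (p := 2) (μ := volume)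
        ENNReal.ofNat_ne_top) g ?_ ?_
    · apply isClosed_eq
      · exact (Lp.fourierTransformₗᵢ E ℂ).continuous.comp
          (Lp.isometry_compMeasurePreserving _).continuous
      · exact (((ContinuousLinearMap.mul ℂ ℂ).holderL volume ∞ 2 2)
          (memLp_top_character a).toLp).continuous.comp (Lp.fourierTransformₗᵢ E ℂ).continuous
    · intro φ
      have h1 : Lp.compMeasurePreserving (fun v : E => v - a)
          (measurePreserving_sub_right volume a) (SchwartzMap.toLpCLM ℝ ℂ 2 volume φ) =
          (φ.compSubConstCLM ℂ a).toLp 2 volume := rfl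
      rw [h1, SchwartzMap.toLpCLM_apply, SchwartzMap.toLp_fourier_eq, SchwartzMap.toLp_fourier_eq]
      apply Lp.ext
      filter_upwards [SchwartzMap.coeFn_toLp (𝓕 (φ.compSubConstCLM ℂ a)) 2 volume,
        SchwartzMap.coeFn_toLp (𝓕 φ) 2 volume, (memLp_top_character a).coeFn_toLp,
        ContinuousLinearMap.coeFn_holder (r := 2) (ContinuousLinearMap.mul ℂ ℂ)
          (memLp_top_character a).toLp ((𝓕 φ).toLp 2 volume)] with ξ h2 h3 h4 h5
      rw [h2, h5, h3, h4, fourier_schwartz_translate]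
      rfl
  rw [key g]
  filter_upwards [(memLp_top_character a).coeFn_toLp,
    ContinuousLinearMap.coeFn_holder (r := 2) (ContinuousLinearMap.mul ℂ ℂ)
      (memLp_top_character a).toLp (𝓕 g : Lp ℂ 2 (volume : Measure E))] with ξ h4 h5
  rw [h5, h4]
  rfl

/-- Plancherel's identity for the increment of an `L²` function. -/
theorem lintegral_increment_eq (g : Lp ℂ 2 (volume : Measure E)) (a : E) :
    ∫⁻ v, ‖g v - g (v - a)‖ₑ ^ 2 =
      ∫⁻ ξ, ‖1 - Complex.exp (-(2 * Real.pi * inner ℝ a ξ : ℝ) * Complex.I)‖ₑ ^ 2 *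
        ‖(𝓕 g : Lp ℂ 2 (volume : Measure E)) ξ‖ₑ ^ 2 := by
  set τg := Lp.compMeasurePreserving (fun v : E => v - a)
    (measurePreserving_sub_right volume a) g with hτ
  have h0 : ‖(g - τg : Lp ℂ 2 (volume : Measure E))‖ₑ ^ 2 =
      ‖(𝓕 (g - τg) : Lp ℂ 2 (volume : Measure E))‖ₑ ^ 2 := by
    rw [← ofReal_norm, ← ofReal_norm, Lp.norm_fourier_eq]
  rw [enorm_sq_eq_lintegral, enorm_sq_eq_lintegral] at h0
  have h1 : ∫⁻ v, ‖g v - g (v - a)‖ₑ ^ 2 =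
      ∫⁻ v, ‖(g - τg : Lp ℂ 2 (volume : Measure E)) v‖ₑ ^ 2 := by
    apply lintegral_congr_ae
    filter_upwards [Lp.coeFn_sub g τg,
      Lp.coeFn_compMeasurePreserving g (measurePreserving_sub_right volume a)] with v h2 h3
    rw [h2, Pi.sub_apply, hτ, h3]
    rfl
  rw [h1, h0]
  apply lintegral_congr_ae
  have h4 : (𝓕 (g - τg) : Lp ℂ 2 (volume : Measure E)) =
      (𝓕 g : Lp ℂ 2 (volume : Measure E)) - (𝓕 τg : Lp ℂ 2 (volume : Measure E)) :=
    (Lp.fourierTransformₗᵢ E ℂ).map_sub g τg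
  filter_upwards [Lp.coeFn_sub (𝓕 g : Lp ℂ 2 (volume : Measure E))
    (𝓕 τg : Lp ℂ 2 (volume : Measure E)), fourier_compMeasurePreserving_sub g a] with ξ h5 h6
  rw [h4, h5, Pi.sub_apply, h6, ← mul_pow, ← enorm_mul]
  congr 2
  ring

end Increments

/-! ### The Gagliardo form and the homogeneous Sobolev norm -/

/-- The symbol of the Gagliardo form is at least a multiple of `‖ξ‖ ^ α`: it is enough to integrate
over a ball of radius comparable to `‖ξ‖⁻¹` on which the phase `⟪y, ξ⟫` stays close to `1 / 4`. -/
theorem exists_le_lintegral_symbol (d : ℕ) {α : ℝ} (hα : 0 < α) :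
    ∃ c : ℝ, 0 < c ∧ ∀ ξ : Vel d, ENNReal.ofReal (c * ‖ξ‖ ^ α) ≤
      ∫⁻ y : Vel d, ‖1 - Complex.exp (-(2 * Real.pi * inner ℝ y ξ : ℝ) * Complex.I)‖ₑ ^ 2 *
        ENNReal.ofReal (‖y‖ ^ (-((d : ℝ) + α))) := by
  set b : ℝ := (volume (Metric.ball (0 : Vel d) 1)).toReal with hb
  have hbfin : volume (Metric.ball (0 : Vel d) 1) ≠ ∞ := measure_ball_lt_top.ne
  have hb0 : 0 < b := ENNReal.toReal_pos (Metric.measure_ball_pos _ _ one_pos).ne' hbfin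
  refine ⟨b / (4 * 8 ^ d), by positivity, fun ξ => ?_⟩
  rcases eq_or_ne ξ 0 with rfl | hξ
  · simp [Real.zero_rpow hα.ne']
  have hn : 0 < ‖ξ‖ := norm_pos_iff.2 hξ
  set B := Metric.ball ((4 * ‖ξ‖ ^ 2)⁻¹ • ξ) (8 * ‖ξ‖)⁻¹ with hB
  have hlow : ∀ y ∈ B, ENNReal.ofReal (1 / 4 * ‖ξ‖ ^ ((d : ℝ) + α)) ≤
      ‖1 - Complex.exp (-(2 * Real.pi * inner ℝ y ξ : ℝ) * Complex.I)‖ₑ ^ 2 *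
        ENNReal.ofReal (‖y‖ ^ (-((d : ℝ) + α))) := by
    intro y hy
    rw [hB, mem_ball_iff_norm] at hy
    have hin : |inner ℝ y ξ - 1 / 4| ≤ 1 / 8 := by
      have h1 : inner ℝ (y - (4 * ‖ξ‖ ^ 2)⁻¹ • ξ) ξ = inner ℝ y ξ - 1 / 4 := by
        rw [inner_sub_left, real_inner_smul_left, real_inner_self_eq_norm_sq]
        field_simp
      rw [← h1]
      refine (abs_real_inner_le_norm _ _).trans ?_
      calc _ ≤ (8 * ‖ξ‖)⁻¹ * ‖ξ‖ := by gcongr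
        _ = 1 / 8 := by field_simp
    have hy0 : y ≠ 0 := by
      rintro rfl
      rw [inner_zero_left] at hin
      norm_num [abs_of_nonneg] at hin
    have hyn : ‖y‖ ≤ ‖ξ‖⁻¹ := by
      have h2 : ‖(4 * ‖ξ‖ ^ 2)⁻¹ • ξ‖ = (4 * ‖ξ‖)⁻¹ := by
        rw [norm_smul, norm_inv, Real.norm_of_nonneg (by positivity)]
        field_simp
      have h3 := norm_le_norm_add_norm_sub' y ((4 * ‖ξ‖ ^ 2)⁻¹ • ξ)
      rw [h2] at h3
      have h4 : (4 * ‖ξ‖)⁻¹ + (8 * ‖ξ‖)⁻¹ = 3 / 8 * ‖ξ‖⁻¹ := by field_simp; norm_num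
      have h5 : 0 < ‖ξ‖⁻¹ := by positivity
      linarith
    have hsin : 1 / 2 ≤ Real.sin (2 * Real.pi * inner ℝ y ξ) := by
      have h6 := Real.one_sub_sq_div_two_le_cos (x := 2 * Real.pi * inner ℝ y ξ - Real.pi / 2)
      rw [Real.cos_sub_pi_div_two] at h6
      refine le_trans ?_ h6
      have h7 : (2 * Real.pi * inner ℝ y ξ - Real.pi / 2) ^ 2 =
          (2 * Real.pi) ^ 2 * (inner ℝ y ξ - 1 / 4) ^ 2 := by ring
      have h8 : (inner ℝ y ξ - 1 / 4) ^ 2 ≤ (1 / 8) ^ 2 := sq_le_sq' (abs_le.1 hin).1 (abs_le.1 hin).2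
      have h9 : (2 * Real.pi) ^ 2 ≤ 64 := by
        nlinarith [Real.pi_le_four, Real.pi_pos]
      rw [h7]
      nlinarith [sq_nonneg (inner ℝ y ξ - 1 / 4)]
    have hnorm : 1 / 2 ≤
        ‖1 - Complex.exp (-(2 * Real.pi * inner ℝ y ξ : ℝ) * Complex.I)‖ := by
      refine hsin.trans ((le_abs_self _).trans (le_of_eq_of_le ?_ (Complex.abs_im_le_norm _)))
      rw [← Complex.ofReal_neg, Complex.sub_im, Complex.exp_ofReal_mul_I_im]
      simp
    rw [← ofReal_norm, ← ENNReal.ofReal_pow (norm_nonneg _), ← ENNReal.ofReal_mul (by positivity)]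
    apply ENNReal.ofReal_le_ofReal
    have h10 : (1 / 4 : ℝ) ≤
        ‖1 - Complex.exp (-(2 * Real.pi * inner ℝ y ξ : ℝ) * Complex.I)‖ ^ 2 := by
      nlinarith
    have h11 : ‖ξ‖ ^ ((d : ℝ) + α) ≤ ‖y‖ ^ (-((d : ℝ) + α)) := by
      rw [Real.rpow_neg (norm_nonneg _), ← Real.inv_rpow (norm_nonneg _)]
      refine Real.rpow_le_rpow hn.le ?_ (by positivity)
      rw [le_inv_comm₀ hn (norm_pos_iff.2 hy0)]
      exact hyn
    gcongr
  calc ENNReal.ofReal (b / (4 * 8 ^ d) * ‖ξ‖ ^ α)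
      = ENNReal.ofReal (1 / 4 * ‖ξ‖ ^ ((d : ℝ) + α)) * volume B := by
        rw [hB, Measure.addHaar_ball_of_pos _ _ (by positivity), finrank_euclideanSpace_fin,
          ← ENNReal.ofReal_toReal hbfin, ← hb, ← ENNReal.ofReal_mul (by positivity),
          ← ENNReal.ofReal_mul (by positivity), Real.rpow_add hn, Real.rpow_natCast]
        congr 1
        field_simp
        rw [← mul_pow, ← mul_pow, mul_one_div_cancel (by positivity), one_pow]
    _ = ∫⁻ _ in B, ENNReal.ofReal (1 / 4 * ‖ξ‖ ^ ((d : ℝ) + α)) := by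
        rw [setLIntegral_const]
    _ ≤ _ := setLIntegral_mono' measurableSet_ball hlow
    _ ≤ _ := setLIntegral_le_lintegral _ _

/-- The Gagliardo form on the Fourier side. -/
theorem lintegral_gagliardo_eq {d : ℕ} (p : ℝ) (g : Lp ℂ 2 (volume : Measure (Vel d))) :
    ∫⁻ v, ∫⁻ w, ‖g v - g w‖ₑ ^ 2 * ENNReal.ofReal (‖v - w‖ ^ (-p)) =
      ∫⁻ ξ, ‖(𝓕 g : Lp ℂ 2 (volume : Measure (Vel d))) ξ‖ₑ ^ 2 *
        ∫⁻ y : Vel d, ‖1 - Complex.exp (-(2 * Real.pi * inner ℝ y ξ : ℝ) * Complex.I)‖ₑ ^ 2 *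
          ENNReal.ofReal (‖y‖ ^ (-p)) := by
  have hg : Measurable g := (Lp.stronglyMeasurable g).measurable
  have hg' : Measurable (𝓕 g : Lp ℂ 2 (volume : Measure (Vel d))) :=
    (Lp.stronglyMeasurable _).measurable
  have hk : Measurable fun y : Vel d => ENNReal.ofReal (‖y‖ ^ (-p)) := by fun_prop
  calc _ = ∫⁻ v, ∫⁻ y, ‖g v - g (v - y)‖ₑ ^ 2 * ENNReal.ofReal (‖y‖ ^ (-p)) := by
        refine lintegral_congr fun v => ?_
        rw [← lintegral_sub_left_eq_self _ v]
        simp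
    _ = ∫⁻ y, ∫⁻ v, ‖g v - g (v - y)‖ₑ ^ 2 * ENNReal.ofReal (‖y‖ ^ (-p)) := by
        apply lintegral_lintegral_swap
        exact Measurable.aemeasurable (by unfold Function.uncurry; fun_prop)
    _ = ∫⁻ y : Vel d, ∫⁻ ξ : Vel d,
          ‖1 - Complex.exp (-(2 * Real.pi * inner ℝ y ξ : ℝ) * Complex.I)‖ₑ ^ 2 *
          ‖(𝓕 g : Lp ℂ 2 (volume : Measure (Vel d))) ξ‖ₑ ^ 2 * ENNReal.ofReal (‖y‖ ^ (-p)) := by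
        refine lintegral_congr fun y => ?_
        rw [lintegral_mul_const _ (by fun_prop), lintegral_mul_const _ (by fun_prop),
          lintegral_increment_eq]
    _ = ∫⁻ ξ : Vel d, ∫⁻ y : Vel d,
          ‖1 - Complex.exp (-(2 * Real.pi * inner ℝ y ξ : ℝ) * Complex.I)‖ₑ ^ 2 *
          ‖(𝓕 g : Lp ℂ 2 (volume : Measure (Vel d))) ξ‖ₑ ^ 2 * ENNReal.ofReal (‖y‖ ^ (-p)) := by
        apply lintegral_lintegral_swap
        exact Measurable.aemeasurable (by unfold Function.uncurry; fun_prop)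
    _ = _ := by
        refine lintegral_congr fun ξ => ?_
        rw [← lintegral_const_mul _ (by fun_prop)]
        refine lintegral_congr fun y => ?_
        ring

/-- The Gagliardo form controls the homogeneous Sobolev norm. -/
theorem exists_homSobolevNormSq_le_gagliardo (d : ℕ) {α : ℝ} (hα : 0 < α) :
    ∃ c : ℝ, 0 < c ∧ ∀ g : Vel d → ℝ, MemLp (fun v => (g v : ℂ)) 2 volume →
      ENNReal.ofReal c * homSobolevNormSq (α / 2) g ≤
        ∫⁻ v, ∫⁻ w, ENNReal.ofReal ((g v - g w) ^ 2 * ‖v - w‖ ^ (-((d : ℝ) + α))) := by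
  obtain ⟨c, hc, hJ⟩ := exists_le_lintegral_symbol d hα
  refine ⟨c * ((2 * Real.pi) ^ α)⁻¹, by positivity, fun g hg => ?_⟩
  set G := hg.toLp with hG
  set S : Vel d → ℂ := fun ξ => (((2 * Real.pi * ‖ξ‖) ^ (2 * (α / 2 / 2)) : ℝ) : ℂ) *
    (𝓕 G : Lp ℂ 2 (volume : Measure (Vel d))) ξ with hS
  have hSm : AEStronglyMeasurable S volume := by
    refine AEStronglyMeasurable.mul (Measurable.aestronglyMeasurable (by fun_prop))
      (Lp.aestronglyMeasurable _)
  have hSsq : ∀ ξ, ‖S ξ‖ₑ ^ 2 = ENNReal.ofReal ((2 * Real.pi) ^ α * ‖ξ‖ ^ α) *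
      ‖(𝓕 G : Lp ℂ 2 (volume : Measure (Vel d))) ξ‖ₑ ^ 2 := by
    intro ξ
    rw [hS]
    simp only
    rw [enorm_mul, mul_pow]
    congr 1
    rw [← ofReal_norm, Complex.norm_real, ← ENNReal.ofReal_pow (norm_nonneg _), Real.norm_eq_abs,
      sq_abs, ← Real.rpow_natCast, ← Real.rpow_mul (by positivity),
      ← Real.mul_rpow (by positivity) (norm_nonneg _)]
    congr 2
    push_cast
    ring
  have hRHS : ∫⁻ v, ∫⁻ w, ENNReal.ofReal ((g v - g w) ^ 2 * ‖v - w‖ ^ (-((d : ℝ) + α))) =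
      ∫⁻ v, ∫⁻ w, ‖G v - G w‖ₑ ^ 2 * ENNReal.ofReal (‖v - w‖ ^ (-((d : ℝ) + α))) := by
    apply lintegral_congr_ae
    filter_upwards [hg.coeFn_toLp] with v hv
    apply lintegral_congr_ae
    filter_upwards [hg.coeFn_toLp] with w hw
    rw [hG, hv, hw, ← ofReal_norm, ← ENNReal.ofReal_pow (norm_nonneg _),
      ← ENNReal.ofReal_mul (by positivity), ← Complex.ofReal_sub, Complex.norm_real,
      Real.norm_eq_abs, sq_abs]
  have hlow : ENNReal.ofReal (c * ((2 * Real.pi) ^ α)⁻¹) * ∫⁻ ξ, ‖S ξ‖ₑ ^ 2 ≤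
      ∫⁻ v, ∫⁻ w, ENNReal.ofReal ((g v - g w) ^ 2 * ‖v - w‖ ^ (-((d : ℝ) + α))) := by
    rw [hRHS, lintegral_gagliardo_eq, ← lintegral_const_mul' _ _ ENNReal.ofReal_ne_top]
    refine lintegral_mono fun ξ => ?_
    simp only
    rw [hSsq, ← mul_assoc, ← ENNReal.ofReal_mul (by positivity), mul_comm]
    gcongr
    refine le_of_eq_of_le ?_ (hJ ξ)
    congr 1
    field_simp
  rcases eq_or_ne (∫⁻ ξ, ‖S ξ‖ₑ ^ 2) ∞ with htop | hfin
  · rw [htop, ENNReal.mul_top (by positivity)] at hlow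
    exact le_top.trans hlow
  refine le_trans ?_ hlow
  gcongr
  have hSmem : MemLp S 2 volume := by
    refine ⟨hSm, ?_⟩
    have h := eLpNorm_nnreal_pow_eq_lintegral (f := S) (μ := (volume : Measure (Vel d)))
      (p := 2) (by simp)
    simp only [NNReal.coe_ofNat, ENNReal.coe_ofNat, ENNReal.rpow_ofNat] at h
    rw [← h] at hfin
    refine lt_top_iff_ne_top.2 fun h' => hfin ?_
    rw [h']
    simp
  refine iInf_le_of_le hg (iInf_le_of_le ((Lp.fourierTransformₗᵢ (Vel d) ℂ).symm hSmem.toLp)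
    (iInf_le_of_le ?_ ?_))
  · unfold IsFracLaplacian
    have h : (𝓕 ((Lp.fourierTransformₗᵢ (Vel d) ℂ).symm hSmem.toLp) :
        Lp ℂ 2 (volume : Measure (Vel d))) = hSmem.toLp :=
      (Lp.fourierTransformₗᵢ (Vel d) ℂ).apply_symm_apply _
    rw [h]
    exact hSmem.coeFn_toLp
  · rw [← ofReal_norm, LinearIsometryEquiv.norm_map, ofReal_norm, enorm_sq_eq_lintegral]
    apply le_of_eq
    apply lintegral_congr_ae
    filter_upwards [hSmem.coeFn_toLp] with ξ h
    rw [h]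

/-! ### Laplace transforms of convolutions and compound Poisson laws -/

/-- The Laplace transform of a measure on the line, with values in `[0,∞]`. -/
noncomputable def laplace (η : Measure ℝ) (s : ℝ) : ℝ≥0∞ :=
  ∫⁻ t, ENNReal.ofReal (Real.exp (-(s * t))) ∂η

theorem laplace_zero (η : Measure ℝ) : laplace η 0 = η Set.univ := by
  simp [laplace]

theorem integral_exp_eq_toReal_laplace (η : Measure ℝ) (s : ℝ) :
    ∫ t, Real.exp (-(s * t)) ∂η = (laplace η s).toReal := by
  rw [laplace, integral_eq_lintegral_of_nonneg_ae (.of_forall fun t => (Real.exp_pos _).le)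
    (Measurable.aestronglyMeasurable (by fun_prop))]

theorem laplace_conv (μ ν : Measure ℝ) [SFinite ν] (s : ℝ) :
    laplace (μ ∗ ν) s = laplace μ s * laplace ν s := by
  unfold laplace
  rw [Measure.lintegral_conv (by fun_prop), ← lintegral_mul_const _ (by fun_prop)]
  refine lintegral_congr fun x => ?_
  rw [← lintegral_const_mul _ (by fun_prop)]
  refine lintegral_congr fun y => ?_
  rw [← ENNReal.ofReal_mul (Real.exp_pos _).le, ← Real.exp_add]
  congr 2
  ring

theorem laplace_smul (c : ℝ≥0∞) (μ : Measure ℝ) (s : ℝ) :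
    laplace (c • μ) s = c * laplace μ s := by
  simp [laplace]

theorem laplace_dirac (a s : ℝ) :
    laplace (Measure.dirac a) s = ENNReal.ofReal (Real.exp (-(s * a))) := by
  simp [laplace]

/-- A convolution is carried by the sum of the sets that carry the factors. -/
theorem ae_conv_of_ae {p q r : ℝ → Prop} {μ ν : Measure ℝ} [SFinite μ] [SFinite ν]
    (hr : MeasurableSet {x | r x}) (hμ : ∀ᵐ x ∂μ, p x) (hν : ∀ᵐ x ∂ν, q x)
    (h : ∀ x y, p x → q y → r (x + y)) : ∀ᵐ x ∂(μ ∗ ν), r x := by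
  rw [Measure.conv, ae_map_iff (by fun_prop) hr]
  have h1 : ∀ᵐ z ∂(μ.prod ν), p z.1 := Measure.quasiMeasurePreserving_fst.ae hμ
  have h2 : ∀ᵐ z ∂(μ.prod ν), q z.2 := Measure.quasiMeasurePreserving_snd.ae hν
  filter_upwards [h1, h2] with z hz1 hz2 using h _ _ hz1 hz2

/-- The convolution powers of a measure. -/
noncomputable def convPow (ν : Measure ℝ) : ℕ → Measure ℝ
  | 0 => Measure.dirac 0
  | n + 1 => convPow ν n ∗ ν

instance isFiniteMeasure_convPow (ν : Measure ℝ) [IsFiniteMeasure ν] (n : ℕ) :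
    IsFiniteMeasure (convPow ν n) := by
  induction n with
  | zero => unfold convPow; infer_instance
  | succ n ih => unfold convPow; infer_instance

theorem laplace_convPow (ν : Measure ℝ) [IsFiniteMeasure ν] (n : ℕ) (s : ℝ) :
    laplace (convPow ν n) s = laplace ν s ^ n := by
  induction n with
  | zero => simp [convPow, laplace_dirac]
  | succ n ih => rw [convPow, laplace_conv, ih, pow_succ]

theorem ae_nonneg_convPow {ν : Measure ℝ} [IsFiniteMeasure ν] (hν : ∀ᵐ t ∂ν, 0 ≤ t) (n : ℕ) :
    ∀ᵐ t ∂(convPow ν n), 0 ≤ t := by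
  induction n with
  | zero =>
    rw [convPow, ae_dirac_iff measurableSet_Ici]
  | succ n ih =>
    exact ae_conv_of_ae measurableSet_Ici ih hν fun x y hx hy => add_nonneg hx hy

/-- The convolution exponential of a measure, that is, a compound Poisson law up to its
normalizing factor. -/
noncomputable def convExp (ν : Measure ℝ) : Measure ℝ :=
  Measure.sum fun n : ℕ => ENNReal.ofReal ((n.factorial : ℝ)⁻¹) • convPow ν n

instance sFinite_convExp (ν : Measure ℝ) [IsFiniteMeasure ν] : SFinite (convExp ν) := by
  unfold convExp
  infer_instance

theorem laplace_convExp {ν : Measure ℝ} [IsFiniteMeasure ν] {s x : ℝ} (hx : 0 ≤ x)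
    (h : laplace ν s = ENNReal.ofReal x) :
    laplace (convExp ν) s = ENNReal.ofReal (Real.exp x) := by
  have h1 : laplace (convExp ν) s =
      ∑' n : ℕ, laplace (ENNReal.ofReal ((n.factorial : ℝ)⁻¹) • convPow ν n) s := by
    unfold laplace convExp
    rw [lintegral_sum_measure]
  have h2 : HasSum (fun n : ℕ => (n.factorial : ℝ)⁻¹ * x ^ n) (Real.exp x) := by
    rw [Real.exp_eq_exp_ℝ]
    simpa [smul_eq_mul] using NormedSpace.exp_series_hasSum_exp' (𝕂 := ℝ) x
  rw [h1, ← h2.tsum_eq, ENNReal.ofReal_tsum_of_nonneg (fun n => by positivity) h2.summable]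
  congr 1 with n
  rw [laplace_smul, laplace_convPow, h, ← ENNReal.ofReal_pow hx,
    ENNReal.ofReal_mul (by positivity)]

theorem ae_nonneg_convExp {ν : Measure ℝ} [IsFiniteMeasure ν] (hν : ∀ᵐ t ∂ν, 0 ≤ t) :
    ∀ᵐ t ∂(convExp ν), 0 ≤ t := by
  unfold convExp
  rw [Measure.ae_sum_iff' measurableSet_Ici]
  exact fun n => Measure.ae_smul_measure (ae_nonneg_convPow hν n) _

/-! ### Approximation of the one-sided stable law -/

theorem integrableOn_levy {β s : ℝ} (hβ0 : 0 < β) (hβ1 : β < 1) (hs : 0 ≤ s) :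
    IntegrableOn (fun t : ℝ => (1 - Real.exp (-(s * t))) * t ^ (-1 - β)) (Set.Ioi 0) := by
  have hm : ∀ S : Set ℝ, AEStronglyMeasurable
      (fun t : ℝ => (1 - Real.exp (-(s * t))) * t ^ (-1 - β)) (volume.restrict S) :=
    fun S => Measurable.aestronglyMeasurable (by fun_prop)
  rw [← Set.Ioc_union_Ioi_eq_Ioi zero_le_one]
  refine IntegrableOn.union ?_ ?_
  · have h1 : IntegrableOn (fun t : ℝ => s * t ^ (-β)) (Set.Ioc 0 1) := by
      have := intervalIntegral.intervalIntegrable_rpow' (a := 0) (b := 1) (r := -β) (by linarith)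
      rw [intervalIntegrable_iff_integrableOn_Ioc_of_le zero_le_one] at this
      exact this.const_mul s
    refine Integrable.mono' h1 (hm _) ?_
    filter_upwards [ae_restrict_mem measurableSet_Ioc] with t ht
    have h2 : Real.exp (-(s * t)) ≤ 1 := Real.exp_le_one_iff.2 (by nlinarith [ht.1])
    have h3 : 1 - Real.exp (-(s * t)) ≤ s * t := by
      linarith [Real.add_one_le_exp (-(s * t))]
    rw [Real.norm_of_nonneg (mul_nonneg (by linarith) (Real.rpow_nonneg ht.1.le _))]
    calc _ ≤ (s * t) * t ^ (-1 - β) := by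
          gcongr
          exact Real.rpow_nonneg ht.1.le _
      _ = s * t ^ (-β) := by
          rw [mul_assoc, ← Real.rpow_one_add' ht.1.le (by linarith)]
          congr 2
          ring
  · refine Integrable.mono' (integrableOn_Ioi_rpow_of_lt (a := -1 - β) (by linarith) one_pos)
      (hm _) ?_
    filter_upwards [ae_restrict_mem measurableSet_Ioi] with t ht
    have ht0 : (0 : ℝ) < t := one_pos.trans ht
    have h2 : Real.exp (-(s * t)) ≤ 1 := Real.exp_le_one_iff.2 (by nlinarith)
    have h3 := Real.exp_pos (-(s * t))
    have h4 : 0 ≤ t ^ (-1 - β) := Real.rpow_nonneg ht0.le _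
    rw [Real.norm_of_nonneg (mul_nonneg (by linarith) h4)]
    nlinarith

theorem integral_levy_scaling {β s : ℝ} (hβ0 : 0 < β) (hs : 0 ≤ s) :
    ∫ t in Set.Ioi (0 : ℝ), (1 - Real.exp (-(s * t))) * t ^ (-1 - β) =
      s ^ β * ∫ t in Set.Ioi (0 : ℝ), (1 - Real.exp (-t)) * t ^ (-1 - β) := by
  rcases hs.eq_or_lt with rfl | hs
  · simp [Real.zero_rpow hβ0.ne']
  have h := integral_comp_mul_left_Ioi
    (fun t : ℝ => (1 - Real.exp (-t)) * t ^ (-1 - β)) 0 hs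
  rw [mul_zero] at h
  have h1 : ∫ t in Set.Ioi (0 : ℝ), (1 - Real.exp (-t)) * t ^ (-1 - β) =
      s * ∫ t in Set.Ioi (0 : ℝ), (1 - Real.exp (-(s * t))) * (s * t) ^ (-1 - β) := by
    rw [h, smul_eq_mul, mul_inv_cancel_left₀ hs.ne']
  rw [h1, ← integral_const_mul, ← integral_const_mul]
  refine setIntegral_congr_fun measurableSet_Ioi fun t ht => ?_
  have h2 : s ^ β * s * s ^ (-1 - β) = 1 := by
    rw [← Real.rpow_add_one hs.ne', ← Real.rpow_add hs, show β + 1 + (-1 - β) = 0 by ring,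
      Real.rpow_zero]
  rw [Real.mul_rpow hs.le (le_of_lt ht)]
  linear_combination (-(1 - Real.exp (-(s * t))) * t ^ (-1 - β)) * h2

theorem integral_levy_pos {β : ℝ} (hβ0 : 0 < β) (hβ1 : β < 1) :
    0 < ∫ t in Set.Ioi (0 : ℝ), (1 - Real.exp (-t)) * t ^ (-1 - β) := by
  have hpos : ∀ t ∈ Set.Ioi (0 : ℝ), 0 < (1 - Real.exp (-t)) * t ^ (-1 - β) := by
    intro t ht
    have h2 : Real.exp (-t) < 1 := Real.exp_lt_one_iff.2 (neg_neg_of_pos ht)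
    exact mul_pos (by linarith) (Real.rpow_pos_of_pos ht _)
  have hint := integrableOn_levy hβ0 hβ1 zero_le_one
  simp only [one_mul] at hint
  rw [setIntegral_pos_iff_support_of_nonneg_ae _ hint]
  · have h : (Set.Ioi (0 : ℝ)) ⊆ Function.support
        (fun t : ℝ => (1 - Real.exp (-t)) * t ^ (-1 - β)) := fun t ht => (hpos t ht).ne'
    rw [Set.inter_eq_right.2 h]
    simp
  · filter_upwards [ae_restrict_mem measurableSet_Ioi] with t ht using (hpos t ht).le

/-- The contribution of the small jumps is at most linear in the Laplace variable. -/
theorem integral_levy_small_le {β s ε : ℝ} (hβ0 : 0 < β) (hβ1 : β < 1) (hs : 0 ≤ s) (hε : 0 < ε) :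
    ∫ t in Set.Ioc (0 : ℝ) ε, (1 - Real.exp (-(s * t))) * t ^ (-1 - β) ≤
      s * (ε ^ (1 - β) / (1 - β)) := by
  have h1 : IntegrableOn (fun t : ℝ => s * t ^ (-β)) (Set.Ioc 0 ε) := by
    have := intervalIntegral.intervalIntegrable_rpow' (a := 0) (b := ε) (r := -β) (by linarith)
    rw [intervalIntegrable_iff_integrableOn_Ioc_of_le hε.le] at this
    exact this.const_mul s
  have h2 : ∫ t in Set.Ioc (0 : ℝ) ε, s * t ^ (-β) = s * (ε ^ (1 - β) / (1 - β)) := by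
    rw [integral_const_mul, ← intervalIntegral.integral_of_le hε.le,
      integral_rpow (Or.inl (by linarith)), Real.zero_rpow (by linarith)]
    rw [sub_zero, neg_add_eq_sub]
  rw [← h2]
  refine setIntegral_mono_on
    ((integrableOn_levy hβ0 hβ1 hs).mono_set Set.Ioc_subset_Ioi_self) h1 measurableSet_Ioc ?_
  intro t ht
  have h3 : 1 - Real.exp (-(s * t)) ≤ s * t := by
    linarith [Real.add_one_le_exp (-(s * t))]
  calc _ ≤ (s * t) * t ^ (-1 - β) := by
        gcongr
        exact Real.rpow_nonneg ht.1.le _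
    _ = s * t ^ (-β) := by
        rw [mul_assoc, ← Real.rpow_one_add' ht.1.le (by linarith)]
        congr 2
        ring

/-- Subordinators approximating the one-sided stable law: there are measures on `(0,∞)` whose
Laplace transforms are squeezed between `e^{-κ s^β - δ s}` and `e^{-κ s^β}`.

They are compound Poisson laws with the jumps of the stable subordinator that exceed a small size.
A deterministic drift `δ`, which dominates the discarded small jumps, restores the upper bound. -/
theorem exists_approx_subordinator {β κ δ : ℝ} (hβ0 : 0 < β) (hβ1 : β < 1) (hκ : 0 < κ)
    (hδ : 0 < δ) :
    ∃ η : Measure ℝ, SFinite η ∧ (∀ᵐ t ∂η, 0 < t) ∧ ∀ s, 0 ≤ s →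
      ENNReal.ofReal (Real.exp (-(κ * s ^ β + δ * s))) ≤ laplace η s ∧
      laplace η s ≤ ENNReal.ofReal (Real.exp (-(κ * s ^ β))) := by
  set c₀ := ∫ t in Set.Ioi (0 : ℝ), (1 - Real.exp (-t)) * t ^ (-1 - β) with hc₀
  have hc₀pos : 0 < c₀ := integral_levy_pos hβ0 hβ1
  set c := κ / c₀ with hc
  have hcpos : 0 < c := by positivity
  have hβ' : 0 < 1 - β := by linarith
  -- the truncation level at which the discarded jumps are compensated exactly by the drift `δ`
  set ε := ((1 - β) * δ / c) ^ (1 - β)⁻¹ with hε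
  have hεpos : 0 < ε := by positivity
  have hεδ : c * (ε ^ (1 - β) / (1 - β)) = δ := by
    rw [hε, Real.rpow_inv_rpow (by positivity) hβ'.ne']
    field_simp
  have hpowint : IntegrableOn (fun t : ℝ => c * t ^ (-1 - β)) (Set.Ioi ε) :=
    (integrableOn_Ioi_rpow_of_lt (by linarith) hεpos).const_mul c
  set ν : Measure ℝ := (volume.restrict (Set.Ioi ε)).withDensity
    (fun t => ENNReal.ofReal (c * t ^ (-1 - β))) with hν
  have hdens : Measurable fun t : ℝ => ENNReal.ofReal (c * t ^ (-1 - β)) := by fun_prop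
  have hνnonneg : ∀ᵐ t ∂ν, 0 ≤ t := by
    refine (withDensity_absolutelyContinuous _ _).ae_le ?_
    filter_upwards [ae_restrict_mem measurableSet_Ioi] with t ht using (hεpos.trans ht).le
  have hexpint : ∀ s, 0 ≤ s →
      IntegrableOn (fun t : ℝ => Real.exp (-(s * t)) * (c * t ^ (-1 - β))) (Set.Ioi ε) := by
    intro s hs
    refine Integrable.mono' hpowint (Measurable.aestronglyMeasurable (by fun_prop)) ?_
    filter_upwards [ae_restrict_mem measurableSet_Ioi] with t ht
    have ht0 : 0 < t := hεpos.trans ht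
    have h2 : Real.exp (-(s * t)) ≤ 1 := Real.exp_le_one_iff.2 (by nlinarith)
    rw [Real.norm_of_nonneg (by positivity)]
    exact mul_le_of_le_one_left (by positivity) h2
  have hlap : ∀ s, 0 ≤ s → laplace ν s =
      ENNReal.ofReal (∫ t in Set.Ioi ε, Real.exp (-(s * t)) * (c * t ^ (-1 - β))) := by
    intro s hs
    rw [laplace, hν, lintegral_withDensity_eq_lintegral_mul _ hdens (by fun_prop),
      ofReal_integral_eq_lintegral_ofReal (hexpint s hs)]
    · refine lintegral_congr fun t => ?_
      rw [Pi.mul_apply, mul_comm, ← ENNReal.ofReal_mul (Real.exp_pos _).le]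
    · filter_upwards [ae_restrict_mem measurableSet_Ioi] with t ht
      have ht0 : 0 < t := hεpos.trans ht
      exact mul_nonneg (Real.exp_pos _).le (by positivity)
  set lam := ∫ t in Set.Ioi ε, c * t ^ (-1 - β) with hlam
  have : IsFiniteMeasure ν := by
    constructor
    rw [← laplace_zero, hlap 0 le_rfl]
    exact ENNReal.ofReal_lt_top
  -- the Laplace exponent of the truncated jump measure
  have hexponent : ∀ s, 0 ≤ s →
      lam - ∫ t in Set.Ioi ε, Real.exp (-(s * t)) * (c * t ^ (-1 - β)) =
        κ * s ^ β - c * ∫ t in Set.Ioc (0 : ℝ) ε, (1 - Real.exp (-(s * t))) * t ^ (-1 - β) := by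
    intro s hs
    have h1 := setIntegral_union (Set.Ioc_disjoint_Ioi (le_refl ε)) measurableSet_Ioi
      ((integrableOn_levy hβ0 hβ1 hs).mono_set Set.Ioc_subset_Ioi_self)
      ((integrableOn_levy hβ0 hβ1 hs).mono_set (Set.Ioi_subset_Ioi hεpos.le))
    rw [Set.Ioc_union_Ioi_eq_Ioi hεpos.le, integral_levy_scaling hβ0 hs, ← hc₀] at h1
    have h2 : lam - ∫ t in Set.Ioi ε, Real.exp (-(s * t)) * (c * t ^ (-1 - β)) =
        c * ∫ t in Set.Ioi ε, (1 - Real.exp (-(s * t))) * t ^ (-1 - β) := by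
      rw [hlam, ← integral_sub hpowint (hexpint s hs), ← integral_const_mul]
      congr 1 with t
      ring
    have h3 : κ * s ^ β = c * (s ^ β * c₀) := by
      rw [hc]
      field_simp
    rw [h2, h3, h1]
    ring
  refine ⟨Measure.dirac δ ∗ (ENNReal.ofReal (Real.exp (-lam)) • convExp ν), ?_, ?_, ?_⟩
  · infer_instance
  · refine ae_conv_of_ae (p := fun t => t = δ) (q := fun t => 0 ≤ t) measurableSet_Ioi ?_
      (Measure.ae_smul_measure (ae_nonneg_convExp hνnonneg) _) ?_
    · simp [ae_dirac_eq]
    · rintro x y rfl hy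
      linarith
  · intro s hs
    have hL : laplace (Measure.dirac δ ∗ (ENNReal.ofReal (Real.exp (-lam)) • convExp ν)) s =
        ENNReal.ofReal (Real.exp (-(κ * s ^ β + δ * s) +
          c * ∫ t in Set.Ioc (0 : ℝ) ε, (1 - Real.exp (-(s * t))) * t ^ (-1 - β))) := by
      have hx : 0 ≤ ∫ t in Set.Ioi ε, Real.exp (-(s * t)) * (c * t ^ (-1 - β)) := by
        refine setIntegral_nonneg measurableSet_Ioi fun t ht => ?_
        have ht0 : 0 < t := hεpos.trans ht
        positivity
      rw [laplace_conv, laplace_dirac, laplace_smul, laplace_convExp hx (hlap s hs),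
        ← ENNReal.ofReal_mul (Real.exp_pos _).le, ← ENNReal.ofReal_mul (Real.exp_pos _).le,
        ← Real.exp_add, ← Real.exp_add]
      congr 2
      linarith [hexponent s hs]
    have h0 : 0 ≤ ∫ t in Set.Ioc (0 : ℝ) ε, (1 - Real.exp (-(s * t))) * t ^ (-1 - β) := by
      refine setIntegral_nonneg measurableSet_Ioc fun t ht => ?_
      have h2 : Real.exp (-(s * t)) ≤ 1 := Real.exp_le_one_iff.2 (by nlinarith [ht.1])
      exact mul_nonneg (by linarith) (Real.rpow_nonneg ht.1.le _)
    have h1 := mul_le_mul_of_nonneg_left (integral_levy_small_le hβ0 hβ1 hs hεpos) hcpos.le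
    have h2 : c * (s * (ε ^ (1 - β) / (1 - β))) = δ * s := by
      rw [← hεδ]
      ring
    rw [hL]
    constructor
    · apply ENNReal.ofReal_le_ofReal
      apply Real.exp_le_exp.2
      have := mul_nonneg hcpos.le h0
      linarith
    · apply ENNReal.ofReal_le_ofReal
      apply Real.exp_le_exp.2
      linarith

/-- A sequence of measures on `(0,∞)` approximating the one-sided stable law with Laplace transform
`e^{-κ s^β}`, dominated by it on the Laplace side. -/
structure IsStableApprox (β κ : ℝ) (η : ℕ → Measure ℝ) : Prop where
  sFinite : ∀ n, SFinite (η n)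
  ae_pos : ∀ n, ∀ᵐ t ∂(η n), 0 < t
  le_laplace : ∀ (n : ℕ) (s : ℝ), 0 ≤ s →
    ENNReal.ofReal (Real.exp (-(κ * s ^ β + 1 / ((n : ℝ) + 1) * s))) ≤ laplace (η n) s
  laplace_le : ∀ n s, 0 ≤ s → laplace (η n) s ≤ ENNReal.ofReal (Real.exp (-(κ * s ^ β)))

theorem exists_isStableApprox {β κ : ℝ} (hβ0 : 0 < β) (hβ1 : β < 1) (hκ : 0 < κ) :
    ∃ η, IsStableApprox β κ η := by
  have h := fun n : ℕ => exists_approx_subordinator hβ0 hβ1 hκ (δ := 1 / ((n : ℝ) + 1))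
    (by positivity)
  choose η h1 h2 h3 using h
  exact ⟨η, h1, h2, fun n s hs => (h3 n s hs).1, fun n s hs => (h3 n s hs).2⟩

namespace IsStableApprox

variable {β κ : ℝ} {η : ℕ → Measure ℝ}

theorem laplace_ne_top (h : IsStableApprox β κ η) (n : ℕ) {s : ℝ} (hs : 0 ≤ s) :
    laplace (η n) s ≠ ∞ :=
  ((h.laplace_le n s hs).trans_lt ENNReal.ofReal_lt_top).ne

theorem measure_univ_le_one (h : IsStableApprox β κ η) (hβ : 0 < β) (n : ℕ) :
    η n Set.univ ≤ 1 := by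
  have := h.laplace_le n 0 le_rfl
  rw [laplace_zero] at this
  simpa [Real.zero_rpow hβ.ne'] using this

theorem integrable_exp (h : IsStableApprox β κ η) (n : ℕ) {s : ℝ} (hs : 0 ≤ s) :
    Integrable (fun t => Real.exp (-(s * t))) (η n) := by
  refine ⟨Measurable.aestronglyMeasurable (by fun_prop), ?_⟩
  rw [hasFiniteIntegral_iff_ofReal (.of_forall fun t => (Real.exp_pos _).le)]
  exact (h.laplace_ne_top n hs).lt_top

theorem toReal_laplace_le (h : IsStableApprox β κ η) (n : ℕ) {s : ℝ} (hs : 0 ≤ s) :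
    (laplace (η n) s).toReal ≤ Real.exp (-(κ * s ^ β)) :=
  ENNReal.toReal_le_of_le_ofReal (Real.exp_pos _).le (h.laplace_le n s hs)

theorem tendsto_laplace (h : IsStableApprox β κ η) {s : ℝ} (hs : 0 ≤ s) :
    Tendsto (fun n => (laplace (η n) s).toReal) atTop (𝓝 (Real.exp (-(κ * s ^ β)))) := by
  have h1 : Tendsto (fun n : ℕ => Real.exp (-(κ * s ^ β + 1 / ((n : ℝ) + 1) * s))) atTop
      (𝓝 (Real.exp (-(κ * s ^ β)))) := by
    have h2 := (((tendsto_one_div_add_atTop_nhds_zero_nat (𝕜 := ℝ)).mul_const s).const_add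
      (κ * s ^ β)).neg
    rw [zero_mul, add_zero] at h2
    exact (Real.continuous_exp.tendsto _).comp h2
  refine tendsto_of_tendsto_of_tendsto_of_le_of_le h1 tendsto_const_nhds (fun n => ?_)
    (fun n => h.toReal_laplace_le n hs)
  exact (ENNReal.ofReal_le_iff_le_toReal (h.laplace_ne_top n hs)).1 (h.le_laplace n s hs)

/-- The negative moments of the approximating measures are bounded uniformly: by Tonelli's theorem
they are integrals of the Laplace transform. -/
theorem exists_lintegral_rpow_neg_le (h : IsStableApprox β κ η) (hβ : 0 < β) (hκ : 0 < κ) {q : ℝ}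
    (hq : 0 < q) :
    ∃ M : ℝ, 0 < M ∧ ∀ n, ∫⁻ t, ENNReal.ofReal (t ^ (-q)) ∂(η n) ≤ ENNReal.ofReal M := by
  have hint : IntegrableOn (fun s : ℝ => s ^ (q - 1) * Real.exp (-κ * s ^ β)) (Set.Ioi 0) :=
    integrableOn_rpow_mul_exp_neg_mul_rpow (by linarith) hβ hκ
  set I := ∫ s in Set.Ioi (0 : ℝ), s ^ (q - 1) * Real.exp (-κ * s ^ β) with hI
  have hI0 : 0 ≤ I := setIntegral_nonneg measurableSet_Ioi fun s hs =>
    mul_nonneg (Real.rpow_nonneg (le_of_lt hs) _) (Real.exp_pos _).le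
  have hΓ : 0 < Real.Gamma q := Real.Gamma_pos_of_pos hq
  refine ⟨(Real.Gamma q)⁻¹ * I + 1, by positivity, fun n => ?_⟩
  have := h.sFinite n
  have hgamma : ∀ t : ℝ, 0 < t → ENNReal.ofReal (t ^ (-q)) =
      ENNReal.ofReal (Real.Gamma q)⁻¹ *
        ∫⁻ s in Set.Ioi (0 : ℝ), ENNReal.ofReal (s ^ (q - 1) * Real.exp (-(s * t))) := by
    intro t ht
    have h1 : IntegrableOn (fun s : ℝ => s ^ (q - 1) * Real.exp (-(s * t))) (Set.Ioi 0) := by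
      have := integrableOn_rpow_mul_exp_neg_mul_rpow (s := q - 1) (p := 1) (b := t)
        (by linarith) one_pos ht
      refine this.congr_fun (fun s _ => ?_) measurableSet_Ioi
      simp only [Real.rpow_one]
      ring_nf
    rw [← ofReal_integral_eq_lintegral_ofReal h1]
    · rw [← ENNReal.ofReal_mul (by positivity)]
      congr 1
      have h2 := Real.integral_rpow_mul_exp_neg_mul_Ioi hq ht
      have h3 : ∫ s in Set.Ioi (0 : ℝ), s ^ (q - 1) * Real.exp (-(s * t)) =
          (1 / t) ^ q * Real.Gamma q := by
        rw [← h2]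
        congr 1 with s
        rw [mul_comm s t]
      rw [h3, Real.rpow_neg ht.le, one_div, Real.inv_rpow ht.le]
      field_simp
    · filter_upwards [ae_restrict_mem measurableSet_Ioi] with s hs
      exact mul_nonneg (Real.rpow_nonneg (le_of_lt hs) _) (Real.exp_pos _).le
  calc ∫⁻ t, ENNReal.ofReal (t ^ (-q)) ∂(η n)
      = ∫⁻ t, ENNReal.ofReal (Real.Gamma q)⁻¹ *
        (∫⁻ s in Set.Ioi (0 : ℝ), ENNReal.ofReal (s ^ (q - 1) * Real.exp (-(s * t)))) ∂(η n) := by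
        apply lintegral_congr_ae
        filter_upwards [h.ae_pos n] with t ht using hgamma t ht
    _ = ENNReal.ofReal (Real.Gamma q)⁻¹ * ∫⁻ s in Set.Ioi (0 : ℝ), ∫⁻ t,
          ENNReal.ofReal (s ^ (q - 1) * Real.exp (-(s * t))) ∂(η n) := by
        rw [lintegral_const_mul' _ _ ENNReal.ofReal_ne_top, lintegral_lintegral_swap]
        exact Measurable.aemeasurable (by unfold Function.uncurry; fun_prop)
    _ ≤ ENNReal.ofReal (Real.Gamma q)⁻¹ * ∫⁻ s in Set.Ioi (0 : ℝ),
          ENNReal.ofReal (s ^ (q - 1) * Real.exp (-κ * s ^ β)) := by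
        gcongr ENNReal.ofReal (Real.Gamma q)⁻¹ * ?_
        refine setLIntegral_mono' measurableSet_Ioi fun s hs => ?_
        have hs0 : 0 ≤ s ^ (q - 1) := Real.rpow_nonneg (le_of_lt hs) _
        simp_rw [ENNReal.ofReal_mul hs0]
        rw [lintegral_const_mul' _ _ ENNReal.ofReal_ne_top]
        gcongr
        refine (h.laplace_le n s (le_of_lt hs)).trans_eq ?_
        rw [neg_mul]
    _ = ENNReal.ofReal ((Real.Gamma q)⁻¹ * I) := by
        rw [← ofReal_integral_eq_lintegral_ofReal hint, ← ENNReal.ofReal_mul (by positivity)]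
        filter_upwards [ae_restrict_mem measurableSet_Ioi] with s hs
        exact mul_nonneg (Real.rpow_nonneg (le_of_lt hs) _) (Real.exp_pos _).le
    _ ≤ _ := ENNReal.ofReal_le_ofReal (by linarith)

end IsStableApprox

/-! ### Superpositions of heat kernels -/

/-- The heat kernel `(4πt)^{-d/2} e^{-‖v‖²/(4t)}`. -/
noncomputable def heat {d : ℕ} (t : ℝ) (v : Vel d) : ℝ :=
  (4 * Real.pi * t) ^ (-((d : ℝ) / 2)) * Real.exp (-(‖v‖ ^ 2 / (4 * t)))

theorem heat_pos {d : ℕ} {t : ℝ} (ht : 0 < t) (v : Vel d) : 0 < heat t v := by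
  unfold heat
  positivity

theorem measurable_heat {d : ℕ} : Measurable fun p : ℝ × Vel d => heat p.1 p.2 := by
  unfold heat
  fun_prop

theorem invFourier_gaussian {d : ℕ} {t : ℝ} (ht : 0 < t) (v : Vel d) :
    invFourier (fun ξ : Vel d => ((Real.exp (-(‖ξ‖ ^ 2 * t)) : ℝ) : ℂ)) v = (heat t v : ℂ) := by
  have h := GaussianFourier.integral_cexp_neg_mul_sq_norm_add (b := (t : ℂ)) (by simpa using ht)
    Complex.I v
  have h1 : ∫ ξ : Vel d, Complex.exp (((inner ℝ v ξ : ℝ) : ℂ) * Complex.I) *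
      ((Real.exp (-(‖ξ‖ ^ 2 * t)) : ℝ) : ℂ) =
      ∫ ξ : Vel d, Complex.exp (-(t : ℂ) * (‖ξ‖ : ℂ) ^ 2 + Complex.I * (inner ℝ v ξ : ℝ)) := by
    congr 1 with ξ
    rw [Complex.ofReal_exp, ← Complex.exp_add]
    congr 1
    push_cast
    ring
  rw [invFourier, h1, h, finrank_euclideanSpace_fin, Complex.I_sq]
  have h2 : ((Real.pi : ℂ) / t) ^ ((d : ℂ) / 2) = (((Real.pi / t) ^ ((d : ℝ) / 2) : ℝ) : ℂ) := by
    rw [Complex.ofReal_cpow (by positivity)]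
    push_cast
    rfl
  have h3 : Complex.exp (-1 * (‖v‖ : ℂ) ^ 2 / (4 * t)) =
      ((Real.exp (-(‖v‖ ^ 2 / (4 * t))) : ℝ) : ℂ) := by
    rw [Complex.ofReal_exp]
    congr 1
    push_cast
    ring
  rw [h2, h3, ← mul_assoc, ← Complex.ofReal_mul, ← Complex.ofReal_mul]
  congr 2
  have h4 : ((2 * Real.pi) ^ d : ℝ) = ((2 * Real.pi) ^ 2) ^ ((d : ℝ) / 2) := by
    rw [← Real.rpow_natCast (2 * Real.pi) 2, ← Real.rpow_mul (by positivity),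
      ← Real.rpow_natCast (2 * Real.pi) d]
    congr 1
    push_cast
    ring
  rw [h4, ← Real.inv_rpow (by positivity), ← Real.mul_rpow (by positivity) (by positivity),
    Real.rpow_neg (by positivity), ← Real.inv_rpow (by positivity)]
  congr 1
  field_simp
  ring

theorem integrable_exp_neg_norm_rpow (d : ℕ) (hd : 1 ≤ d) {κ α : ℝ} (hκ : 0 < κ) (hα : 0 < α) :
    Integrable fun ξ : Vel d => Real.exp (-(κ * ‖ξ‖ ^ α)) := by
  have : Nonempty (Fin d) := ⟨⟨0, hd⟩⟩
  rw [integrable_fun_norm_addHaar (volume : Measure (Vel d))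
    (f := fun x : ℝ => Real.exp (-(κ * x ^ α)))]
  have h1 := integrableOn_rpow_mul_exp_neg_mul_rpow
    (s := ((d - 1 : ℕ) : ℝ)) (p := α) (b := κ)
    (lt_of_lt_of_le (by norm_num) (Nat.cast_nonneg _)) hα hκ
  refine h1.congr_fun (fun x _ => ?_) measurableSet_Ioi
  simp only [finrank_euclideanSpace_fin, Real.rpow_natCast, smul_eq_mul, neg_mul]

theorem integrable_exp_neg_norm_sq_rpow {d : ℕ} (hd : 1 ≤ d) {β κ : ℝ} (hβ : 0 < β) (hκ : 0 < κ) :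
    Integrable fun ξ : Vel d => Real.exp (-(κ * (‖ξ‖ ^ 2) ^ β)) := by
  refine (integrable_exp_neg_norm_rpow d hd hκ (α := 2 * β) (by positivity)).congr
    (.of_forall fun ξ => ?_)
  simp only
  rw [Real.rpow_mul (norm_nonneg _), Real.rpow_two]

/-- The superposition of heat kernels with respect to a measure on the time axis. -/
noncomputable def heatMixture {d : ℕ} (η : Measure ℝ) (v : Vel d) : ℝ := ∫ t, heat t v ∂η

namespace IsStableApprox

variable {β κ : ℝ} {η : ℕ → Measure ℝ}

theorem integrable_heat {d : ℕ} (hd : 1 ≤ d) (h : IsStableApprox β κ η) (hβ : 0 < β) (hκ : 0 < κ)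
    (n : ℕ) (v : Vel d) : Integrable (fun t => heat t v) (η n) := by
  obtain ⟨M, -, hM⟩ := h.exists_lintegral_rpow_neg_le hβ hκ (q := (d : ℝ) / 2) (by positivity)
  have h1 : Integrable (fun t : ℝ => t ^ (-((d : ℝ) / 2))) (η n) := by
    refine ⟨Measurable.aestronglyMeasurable (by fun_prop), ?_⟩
    rw [hasFiniteIntegral_iff_ofReal]
    · exact (hM n).trans_lt ENNReal.ofReal_lt_top
    · filter_upwards [h.ae_pos n] with t ht using by positivity
  refine (h1.const_mul ((4 * Real.pi) ^ (-((d : ℝ) / 2)))).mono'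
    (measurable_heat.comp measurable_prodMk_right).aestronglyMeasurable ?_
  filter_upwards [h.ae_pos n] with t ht
  rw [Real.norm_of_nonneg (heat_pos ht v).le, heat, Real.mul_rpow (by positivity) ht.le]
  refine mul_le_of_le_one_right (by positivity) (Real.exp_le_one_iff.2 ?_)
  rw [neg_nonpos]
  positivity

/-- A superposition of heat kernels is the inverse Fourier transform of the Laplace transform of
the mixing measure, evaluated at `‖ξ‖²`. -/
theorem heatMixture_eq_invFourier {d : ℕ} (hd : 1 ≤ d) (h : IsStableApprox β κ η) (hβ : 0 < β)
    (hκ : 0 < κ) (n : ℕ) (v : Vel d) :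
    (heatMixture (η n) v : ℂ) =
      invFourier (fun ξ : Vel d => (((laplace (η n) (‖ξ‖ ^ 2)).toReal : ℝ) : ℂ)) v := by
  have := h.sFinite n
  set Ψ : ℝ → Vel d → ℂ := fun t ξ => Complex.exp (((inner ℝ v ξ : ℝ) : ℂ) * Complex.I) *
    ((Real.exp (-(‖ξ‖ ^ 2 * t)) : ℝ) : ℂ) with hΨ
  have hΨm : Measurable (Function.uncurry Ψ) := by
    rw [hΨ]
    unfold Function.uncurry
    fun_prop
  have hΨn : ∀ t ξ, ‖Ψ t ξ‖ = Real.exp (-(‖ξ‖ ^ 2 * t)) := by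
    intro t ξ
    rw [hΨ]
    simp only
    rw [norm_mul, Complex.norm_exp_ofReal_mul_I, one_mul, Complex.norm_real,
      Real.norm_of_nonneg (Real.exp_pos _).le]
  have hint : Integrable (Function.uncurry Ψ) ((η n).prod volume) := by
    rw [integrable_prod_iff' hΨm.aestronglyMeasurable]
    constructor
    · refine .of_forall fun ξ => ?_
      refine (h.integrable_exp n (sq_nonneg ‖ξ‖)).mono'
        (hΨm.comp measurable_prodMk_right).aestronglyMeasurable (.of_forall fun t => ?_)
      exact (hΨn t ξ).le
    · simp only [Function.uncurry_apply_pair, hΨn, integral_exp_eq_toReal_laplace]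
      refine (integrable_exp_neg_norm_sq_rpow hd hβ hκ).mono' ?_ (.of_forall fun ξ => ?_)
      · apply Measurable.aestronglyMeasurable
        refine Measurable.ennreal_toReal ?_
        unfold laplace
        refine Measurable.lintegral_prod_right' (f := fun p : Vel d × ℝ =>
          ENNReal.ofReal (Real.exp (-(‖p.1‖ ^ 2 * p.2)))) ?_
        fun_prop
      · rw [Real.norm_of_nonneg ENNReal.toReal_nonneg]
        exact h.toReal_laplace_le n (sq_nonneg _)
  calc (heatMixture (η n) v : ℂ) = ∫ t, (heat t v : ℂ) ∂(η n) := integral_complex_ofReal.symm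
    _ = ∫ t, (((2 * Real.pi) ^ d)⁻¹ : ℝ) * (∫ ξ, Ψ t ξ) ∂(η n) := by
        apply integral_congr_ae
        filter_upwards [h.ae_pos n] with t ht
        rw [← invFourier_gaussian ht]
        rfl
    _ = (((2 * Real.pi) ^ d)⁻¹ : ℝ) * ∫ ξ, ∫ t, Ψ t ξ ∂(η n) := by
        rw [integral_const_mul, integral_integral_swap hint]
    _ = _ := by
        rw [invFourier]
        congr 1
        congr 1 with ξ
        rw [hΨ]
        simp only
        rw [integral_const_mul, integral_complex_ofReal, integral_exp_eq_toReal_laplace]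

/-- The superpositions of heat kernels converge to the inverse Fourier transform of
`e^{-κ‖ξ‖^{2β}}`. -/
theorem tendsto_heatMixture {d : ℕ} (hd : 1 ≤ d) (h : IsStableApprox β κ η) (hβ : 0 < β)
    (hκ : 0 < κ) (v : Vel d) :
    Tendsto (fun n => heatMixture (η n) v) atTop
      (𝓝 (invFourier (fun ξ : Vel d => ((Real.exp (-(κ * (‖ξ‖ ^ 2) ^ β)) : ℝ) : ℂ)) v).re) := by
  have h1 : Tendsto (fun n => (heatMixture (η n) v : ℂ)) atTop
      (𝓝 (invFourier (fun ξ : Vel d => ((Real.exp (-(κ * (‖ξ‖ ^ 2) ^ β)) : ℝ) : ℂ)) v)) := by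
    simp_rw [h.heatMixture_eq_invFourier hd hβ hκ]
    unfold invFourier
    refine Tendsto.const_mul _ ?_
    refine tendsto_integral_of_dominated_convergence
      (fun ξ : Vel d => Real.exp (-(κ * (‖ξ‖ ^ 2) ^ β))) (fun n => ?_)
      (integrable_exp_neg_norm_sq_rpow hd hβ hκ) (fun n => .of_forall fun ξ => ?_) (.of_forall fun ξ => ?_)
    · have := h.sFinite n
      apply Measurable.aestronglyMeasurable
      refine Measurable.mul (by fun_prop) ?_
      refine Complex.measurable_ofReal.comp (Measurable.ennreal_toReal ?_)
      unfold laplace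
      refine Measurable.lintegral_prod_right' (f := fun p : Vel d × ℝ =>
        ENNReal.ofReal (Real.exp (-(‖p.1‖ ^ 2 * p.2)))) ?_
      fun_prop
    · rw [norm_mul, Complex.norm_exp_ofReal_mul_I, one_mul, Complex.norm_real,
        Real.norm_of_nonneg ENNReal.toReal_nonneg]
      exact h.toReal_laplace_le n (sq_nonneg _)
    · exact ((Complex.continuous_ofReal.tendsto _).comp
        (h.tendsto_laplace (sq_nonneg ‖ξ‖))).const_mul _
  have h2 := (Complex.continuous_re.tendsto _).comp h1
  simpa [Function.comp_def] using h2

theorem tendsto_unnormalizedEquilibrium {d : ℕ} (hd : 1 ≤ d) {α : ℝ} (hα : 0 < α)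
    (h : IsStableApprox (α / 2) α⁻¹ η) (v : Vel d) :
    Tendsto (fun n => heatMixture (η n) v) atTop (𝓝 (unnormalizedEquilibrium α v)) := by
  have h1 := h.tendsto_heatMixture hd (by positivity) (by positivity) v
  have h2 : ∀ ξ : Vel d, α⁻¹ * (‖ξ‖ ^ 2) ^ (α / 2) = ‖ξ‖ ^ α / α := by
    intro ξ
    rw [← Real.rpow_natCast ‖ξ‖ 2, ← Real.rpow_mul (norm_nonneg _), inv_mul_eq_div]
    congr 2
    push_cast
    ring
  simp_rw [h2] at h1
  exact h1

end IsStableApprox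

/-! ### The heavy tail of the equilibrium -/

/-- A combination of four exponentials that vanishes at `0` and at infinity, and that is negative
near `0` if `1 < A * K`. -/
noncomputable def tailTest (A K τ : ℝ) : ℝ :=
  (Real.exp (-τ) - Real.exp (-(2 * τ))) - A * (Real.exp (-(K * τ)) - Real.exp (-(2 * K * τ)))

theorem tailTest_nonpos {A K τ : ℝ} (hA : 0 < A) (hK : 0 < K) (hAK : 2 ≤ A * K) (hτ : 0 ≤ τ)
    (hτK : K * τ ≤ 1 / 4) : tailTest A K τ ≤ 0 := by
  have h1 : Real.exp (-(2 * τ)) = Real.exp (-τ) * Real.exp (-τ) := by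
    rw [← Real.exp_add]; ring_nf
  have h2 : Real.exp (-(2 * K * τ)) = Real.exp (-(K * τ)) * Real.exp (-(K * τ)) := by
    rw [← Real.exp_add]; ring_nf
  have h3 : Real.exp (-τ) ≤ 1 := Real.exp_le_one_iff.2 (by linarith)
  have h4 : 1 - τ ≤ Real.exp (-τ) := by linarith [Real.add_one_le_exp (-τ)]
  have h5 : Real.exp (-τ) - Real.exp (-(2 * τ)) ≤ τ := by
    rw [h1]; nlinarith [Real.exp_pos (-τ)]
  have h6 : 1 - 2 * K * τ ≤ Real.exp (-(2 * K * τ)) := by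
    linarith [Real.add_one_le_exp (-(2 * K * τ))]
  have h7 : Real.exp (-(K * τ)) = Real.exp (-(2 * K * τ)) * Real.exp (K * τ) := by
    rw [← Real.exp_add]; ring_nf
  have h8 : K * τ + 1 ≤ Real.exp (K * τ) := Real.add_one_le_exp _
  have hKτ : 0 ≤ K * τ := by positivity
  have h9 : 1 / 2 * (K * τ) ≤ Real.exp (-(K * τ)) - Real.exp (-(2 * K * τ)) := by
    rw [h7]
    have h10 : 1 / 2 ≤ Real.exp (-(2 * K * τ)) := by linarith
    nlinarith
  unfold tailTest
  have h11 : τ ≤ A * (1 / 2 * (K * τ)) := by nlinarith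
  have h12 := mul_le_mul_of_nonneg_left h9 hA.le
  linarith

theorem rpow_half_mul_exp_neg_le (d : ℕ) {τ : ℝ} (hτ : 0 < τ) :
    τ ^ ((d : ℝ) / 2) * Real.exp (-τ) ≤ 1 + d.factorial := by
  have h1 : τ ^ ((d : ℝ) / 2) ≤ 1 + τ ^ d := by
    rcases le_total τ 1 with h | h
    · have := Real.rpow_le_one hτ.le h (by positivity : (0 : ℝ) ≤ (d : ℝ) / 2)
      have : 0 ≤ τ ^ d := by positivity
      linarith
    · have := Real.rpow_le_rpow_of_exponent_le h
        (by linarith [(Nat.cast_nonneg d : (0 : ℝ) ≤ d)] : (d : ℝ) / 2 ≤ d)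
      rw [Real.rpow_natCast] at this
      linarith
  have h2 := Real.pow_div_factorial_le_exp τ hτ.le d
  rw [div_le_iff₀ (by positivity)] at h2
  have h3 : 1 ≤ Real.exp τ := Real.one_le_exp hτ.le
  rw [Real.exp_neg, ← div_eq_mul_inv, div_le_iff₀ (Real.exp_pos _)]
  linarith

/-- The profile of the heat kernel in the time variable dominates the test function. -/
theorem exists_mul_tailTest_le (d : ℕ) {A K : ℝ} (hA : 0 < A) (hK : 0 < K) (hAK : 2 ≤ A * K) :
    ∃ c : ℝ, 0 < c ∧ ∀ τ : ℝ, 0 < τ →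
      c * tailTest A K τ ≤ τ ^ (-((d : ℝ) / 2)) * Real.exp (-(1 / (4 * τ))) := by
  refine ⟨Real.exp (-K) / (1 + d.factorial), by positivity, fun τ hτ => ?_⟩
  rcases le_or_gt (K * τ) (1 / 4) with h | h
  · have h1 := tailTest_nonpos hA hK hAK hτ.le h
    exact (mul_nonpos_of_nonneg_of_nonpos (by positivity) h1).trans (by positivity)
  · have h1 : tailTest A K τ ≤ Real.exp (-τ) := by
      have h2 : Real.exp (-(2 * K * τ)) ≤ Real.exp (-(K * τ)) :=
        Real.exp_le_exp.2 (by nlinarith)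
      have h3 := Real.exp_pos (-(2 * τ))
      have h4 := mul_nonneg hA.le (sub_nonneg.2 h2)
      unfold tailTest
      linarith
    have h2 : Real.exp (-K) ≤ Real.exp (-(1 / (4 * τ))) := by
      apply Real.exp_le_exp.2
      rw [neg_le_neg_iff, div_le_iff₀ (by positivity)]
      linarith
    have h3 := rpow_half_mul_exp_neg_le d hτ
    have h4 : Real.exp (-τ) / (1 + d.factorial) ≤ τ ^ (-((d : ℝ) / 2)) := by
      rw [Real.rpow_neg hτ.le, div_le_iff₀ (by positivity), inv_mul_eq_div,
        le_div_iff₀ (by positivity), mul_comm]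
      exact h3
    calc _ ≤ Real.exp (-K) / (1 + d.factorial) * Real.exp (-τ) := by gcongr
      _ = Real.exp (-τ) / (1 + d.factorial) * Real.exp (-K) := by ring
      _ ≤ _ := by gcongr

/-- Against the stable law the test function has an integral of the order of `s ^ β`: the function
`s ↦ s ^ β` lies strictly between the exponents `0` and `1`, for which `tailTest` is balanced. -/
theorem le_stable_tailTest {β κ s K A : ℝ} (hβ0 : 0 < β) (hβ1 : β < 1) (hκ : 0 < κ)
    (hs : 0 ≤ s) (hK : 0 < K) (hA : 0 < A) (hAK : A * K ^ β = 1 / 4) (hsmall : κ * s ^ β ≤ 1 / 4) :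
    ((2 : ℝ) ^ β - 1) / 4 * (κ * s ^ β) ≤
      (Real.exp (-(κ * s ^ β)) - Real.exp (-(κ * (2 * s) ^ β))) -
        A * (Real.exp (-(κ * (K * s) ^ β)) - Real.exp (-(κ * (2 * K * s) ^ β))) := by
  set b := (2 : ℝ) ^ β with hb
  set x := κ * s ^ β with hx
  have hx0 : 0 ≤ x := mul_nonneg hκ.le (Real.rpow_nonneg hs _)
  have hb1 : 1 < b := Real.one_lt_rpow one_lt_two hβ0
  have hb2 : b ≤ 2 := by
    simpa using Real.rpow_le_rpow_of_exponent_le one_le_two hβ1.le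
  have e1 : κ * (2 * s) ^ β = b * x := by rw [Real.mul_rpow zero_le_two hs, hx]; ring
  have e2 : κ * (K * s) ^ β = K ^ β * x := by rw [Real.mul_rpow hK.le hs, hx]; ring
  have e3 : κ * (2 * K * s) ^ β = b * (K ^ β * x) := by
    rw [Real.mul_rpow (by positivity) hs, Real.mul_rpow zero_le_two hK.le, hx]; ring
  rw [e1, e2, e3]
  have h1 : 1 / 2 ≤ Real.exp (-(b * x)) := by
    have := Real.add_one_le_exp (-(b * x))
    nlinarith
  have h2 : Real.exp (-x) = Real.exp (-(b * x)) * Real.exp ((b - 1) * x) := by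
    rw [← Real.exp_add]; ring_nf
  have h3 : (b - 1) * x + 1 ≤ Real.exp ((b - 1) * x) := Real.add_one_le_exp _
  have hbx : 0 ≤ (b - 1) * x := mul_nonneg (by linarith) hx0
  have h4 : 1 / 2 * ((b - 1) * x) ≤ Real.exp (-x) - Real.exp (-(b * x)) := by
    rw [h2]; nlinarith
  set y := K ^ β * x with hy
  have hy0 : 0 ≤ y := mul_nonneg (Real.rpow_nonneg hK.le _) hx0
  have h5 : Real.exp (-(b * y)) = Real.exp (-y) * Real.exp (-((b - 1) * y)) := by
    rw [← Real.exp_add]; ring_nf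
  have h6 : 1 - (b - 1) * y ≤ Real.exp (-((b - 1) * y)) := by
    linarith [Real.add_one_le_exp (-((b - 1) * y))]
  have hby : 0 ≤ (b - 1) * y := mul_nonneg (by linarith) hy0
  have h7 : Real.exp (-y) ≤ 1 := Real.exp_le_one_iff.2 (by linarith)
  have h8 : Real.exp (-y) - Real.exp (-(b * y)) ≤ (b - 1) * y := by
    rw [h5]; nlinarith [Real.exp_pos (-y)]
  have h9 := mul_le_mul_of_nonneg_left h8 hA.le
  have h10 : A * ((b - 1) * y) = 1 / 4 * ((b - 1) * x) := by
    rw [hy, ← hAK]; ring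
  linarith

/-- The heavy tail of the equilibrium: on a large ball of radius `r` it is at least a multiple of
`r ^ (-(d + α))`. -/
theorem exists_le_unnormalizedEquilibrium (d : ℕ) (hd : 1 ≤ d) {α : ℝ} (hα0 : 0 < α)
    (hα2 : α < 2) :
    ∃ c R : ℝ, 0 < c ∧ 1 ≤ R ∧ ∀ r, R ≤ r → ∀ w : Vel d, ‖w‖ ≤ r →
      c * r ^ (-((d : ℝ) + α)) ≤ unnormalizedEquilibrium α w := by
  set β := α / 2 with hβ
  have hβ0 : 0 < β := by positivity
  have hβ1 : β < 1 := by linarith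
  have hβ' : 0 < 1 - β := by linarith
  -- `K` and `A` are chosen such that `A * K ^ β < 1 < A * K`, which `0 < β < 1` permits
  set K := (8 : ℝ) ^ (1 - β)⁻¹ with hK
  have hK0 : 0 < K := by positivity
  have hK8 : K ^ (1 - β) = 8 := by rw [hK, Real.rpow_inv_rpow (by norm_num) hβ'.ne']
  set A := K ^ (-β) / 4 with hA
  have hA0 : 0 < A := by positivity
  have hAK : A * K = 2 := by
    have : K ^ (-β) * K = 8 := by
      rw [← Real.rpow_add_one hK0.ne', ← hK8]
      congr 1
      ring
    rw [hA]
    linarith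
  have hAKβ : A * K ^ β = 1 / 4 := by
    have : K ^ (-β) * K ^ β = 1 := by
      rw [← Real.rpow_add hK0]
      simp
    rw [hA]
    linarith
  obtain ⟨c₁, hc₁, hF⟩ := exists_mul_tailTest_le d hA0 hK0 hAK.ge
  obtain ⟨η, hη⟩ := exists_isStableApprox hβ0 hβ1 (inv_pos.2 hα0)
  have h2β : (1 : ℝ) < 2 ^ β := Real.one_lt_rpow one_lt_two hβ0
  set C := (4 * Real.pi) ^ (-((d : ℝ) / 2)) * c₁ with hC
  have hC0 : 0 < C := by positivity
  refine ⟨C * (((2 : ℝ) ^ β - 1) / 4 * α⁻¹), max 1 ((4 * α⁻¹) ^ α⁻¹), ?_, le_max_left _ _, ?_⟩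
  · have : 0 < (2 : ℝ) ^ β - 1 := by linarith
    positivity
  intro r hr w hw
  have hr0 : 0 < r := one_pos.trans_le ((le_max_left _ _).trans hr)
  set s := (r ^ 2)⁻¹ with hs
  have hs0 : 0 ≤ s := by positivity
  have hsβ : s ^ β = r ^ (-α) := by
    rw [hs, Real.inv_rpow (by positivity), ← Real.rpow_natCast, ← Real.rpow_mul hr0.le,
      ← Real.rpow_neg hr0.le]
    congr 2
    push_cast
    ring
  have hsmall : α⁻¹ * s ^ β ≤ 1 / 4 := by
    have h1 : 4 * α⁻¹ ≤ r ^ α := by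
      have h2 := Real.rpow_le_rpow (by positivity) ((le_max_right _ _).trans hr) hα0.le
      rwa [Real.rpow_inv_rpow (by positivity) hα0.ne'] at h2
    rw [hsβ, Real.rpow_neg hr0.le, ← div_eq_mul_inv, div_le_iff₀ (by positivity)]
    linarith
  have hlim := le_stable_tailTest hβ0 hβ1 (inv_pos.2 hα0) hs0 hK0 hA0 hAKβ hsmall
  have hT : Tendsto (fun n => C * r ^ (-(d : ℝ)) *
      (((laplace (η n) s).toReal - (laplace (η n) (2 * s)).toReal) -
        A * ((laplace (η n) (K * s)).toReal - (laplace (η n) (2 * K * s)).toReal))) atTop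
      (𝓝 (C * r ^ (-(d : ℝ)) *
      ((Real.exp (-(α⁻¹ * s ^ β)) - Real.exp (-(α⁻¹ * (2 * s) ^ β))) -
        A * (Real.exp (-(α⁻¹ * (K * s) ^ β)) - Real.exp (-(α⁻¹ * (2 * K * s) ^ β)))))) :=
    (((hη.tendsto_laplace hs0).sub (hη.tendsto_laplace (by positivity))).sub
      (((hη.tendsto_laplace (by positivity)).sub
        (hη.tendsto_laplace (by positivity))).const_mul A)).const_mul _
  have hle : ∀ n, C * r ^ (-(d : ℝ)) *
      (((laplace (η n) s).toReal - (laplace (η n) (2 * s)).toReal) -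
        A * ((laplace (η n) (K * s)).toReal - (laplace (η n) (2 * K * s)).toReal)) ≤
      heatMixture (η n) w := by
    intro n
    have i1 := hη.integrable_exp n hs0
    have i2 := hη.integrable_exp n (s := 2 * s) (by positivity)
    have i3 := hη.integrable_exp n (s := K * s) (by positivity)
    have i4 := hη.integrable_exp n (s := 2 * K * s) (by positivity)
    have i12 : Integrable (fun t => Real.exp (-(s * t)) - Real.exp (-(2 * s * t))) (η n) :=
      i1.sub i2
    have i34 : Integrable (fun t => A * (Real.exp (-(K * s * t)) - Real.exp (-(2 * K * s * t))))
      (η n) := (i3.sub i4).const_mul A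
    simp only [← integral_exp_eq_toReal_laplace]
    rw [← integral_sub i1 i2, ← integral_sub i3 i4, ← integral_const_mul,
      ← integral_sub i12 i34, ← integral_const_mul]
    refine integral_mono_ae ((i12.sub i34).const_mul _)
      (hη.integrable_heat hd hβ0 (inv_pos.2 hα0) n w) ?_
    filter_upwards [hη.ae_pos n] with t ht
    have h1 := hF (s * t) (by positivity)
    have h2 : (Real.exp (-(s * t)) - Real.exp (-(2 * s * t))) -
        A * (Real.exp (-(K * s * t)) - Real.exp (-(2 * K * s * t))) = tailTest A K (s * t) := by
      unfold tailTest
      ring_nf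
    rw [h2]
    have h3 : r ^ (-(d : ℝ)) * (s * t) ^ (-((d : ℝ) / 2)) = t ^ (-((d : ℝ) / 2)) := by
      rw [Real.mul_rpow hs0 ht.le, hs, Real.inv_rpow (by positivity), ← Real.rpow_natCast,
        ← Real.rpow_mul hr0.le, ← Real.rpow_neg hr0.le, ← mul_assoc, ← Real.rpow_add hr0]
      push_cast
      rw [show -(d : ℝ) + -(2 * -((d : ℝ) / 2)) = 0 by ring, Real.rpow_zero, one_mul]
    have h4 : Real.exp (-(1 / (4 * (s * t)))) ≤ Real.exp (-(‖w‖ ^ 2 / (4 * t))) := by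
      apply Real.exp_le_exp.2
      have h5 : 1 / (4 * (s * t)) = r ^ 2 / (4 * t) := by
        rw [hs]
        field_simp
      rw [h5, neg_le_neg_iff]
      gcongr
    calc C * r ^ (-(d : ℝ)) * tailTest A K (s * t)
        = (4 * Real.pi) ^ (-((d : ℝ) / 2)) * r ^ (-(d : ℝ)) * (c₁ * tailTest A K (s * t)) := by
          rw [hC]; ring
      _ ≤ (4 * Real.pi) ^ (-((d : ℝ) / 2)) * r ^ (-(d : ℝ)) *
          ((s * t) ^ (-((d : ℝ) / 2)) * Real.exp (-(1 / (4 * (s * t))))) := by gcongr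
      _ = (4 * Real.pi * t) ^ (-((d : ℝ) / 2)) * Real.exp (-(1 / (4 * (s * t)))) := by
          rw [Real.mul_rpow (by positivity : 0 ≤ 4 * Real.pi) ht.le, ← h3]; ring
      _ ≤ heat t w := by
          unfold heat
          gcongr
  refine le_trans ?_ (le_of_tendsto_of_tendsto' hT
    (hη.tendsto_unnormalizedEquilibrium hd hα0 w) hle)
  rw [hsβ] at hlim
  calc C * (((2 : ℝ) ^ β - 1) / 4 * α⁻¹) * r ^ (-((d : ℝ) + α))
      = C * r ^ (-(d : ℝ)) * (((2 : ℝ) ^ β - 1) / 4 * (α⁻¹ * r ^ (-α))) := by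
        rw [neg_add, Real.rpow_add hr0]; ring
    _ ≤ _ := by rw [hsβ]; gcongr

/-! ### The energy of the square root of a heat kernel -/

/-- The carré du champ of `√u` at `w` for the fractional Laplacian: the integral
`∫ (√u(v) - √u(w))² ‖v - w‖^{-p} dv`, with `p = d + α` in the applications. -/
noncomputable def sqrtEnergy {d : ℕ} (p : ℝ) (u : Vel d → ℝ) (w : Vel d) : ℝ≥0∞ :=
  ∫⁻ v, ENNReal.ofReal ((√(u v) - √(u w)) ^ 2 * ‖v - w‖ ^ (-p))

theorem exists_rpow_mul_exp_neg_le (q : ℝ) {c : ℝ} (hc : 0 < c) :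
    ∃ C : ℝ, 0 < C ∧ ∀ x : ℝ, 1 ≤ x → Real.exp (-(c * x)) ≤ C * x ^ (-q) := by
  set N := ⌈q⌉₊
  refine ⟨N.factorial / c ^ N, by positivity, fun x hx => ?_⟩
  have hx0 : 0 < x := one_pos.trans_le hx
  have h1 : x ^ q ≤ x ^ N := by
    rw [← Real.rpow_natCast]
    exact Real.rpow_le_rpow_of_exponent_le hx (Nat.le_ceil q)
  have h2 := Real.pow_div_factorial_le_exp (c * x) (by positivity) N
  rw [div_le_iff₀ (by positivity), mul_pow] at h2
  rw [Real.rpow_neg hx0.le, Real.exp_neg, ← div_eq_mul_inv, le_div_iff₀ (by positivity),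
    inv_mul_le_iff₀ (Real.exp_pos _), mul_div_assoc', le_div_iff₀ (by positivity)]
  have h3 : x ^ q * c ^ N ≤ x ^ N * c ^ N := by gcongr
  linarith

theorem abs_exp_neg_sub_exp_neg_le {a b m : ℝ} (ha : m ≤ a) (hb : m ≤ b) :
    |Real.exp (-a) - Real.exp (-b)| ≤ Real.exp (-m) * |a - b| := by
  wlog hab : a ≤ b generalizing a b
  · rw [abs_sub_comm, abs_sub_comm a b]
    exact this hb ha (le_of_not_ge hab)
  have h1 : Real.exp (-b) = Real.exp (-a) * Real.exp (-(b - a)) := by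
    rw [← Real.exp_add]; ring_nf
  have h2 : 1 - (b - a) ≤ Real.exp (-(b - a)) := by linarith [Real.add_one_le_exp (-(b - a))]
  have h3 : Real.exp (-b) ≤ Real.exp (-a) := Real.exp_le_exp.2 (by linarith)
  have h4 : Real.exp (-a) ≤ Real.exp (-m) := Real.exp_le_exp.2 (by linarith)
  rw [abs_of_nonneg (by linarith), abs_of_nonpos (by linarith)]
  calc _ ≤ Real.exp (-a) * (b - a) := by rw [h1]; nlinarith [Real.exp_pos (-a)]
    _ ≤ Real.exp (-m) * (b - a) := by gcongr
    _ = _ := by ring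

/-- The truncated singular kernel `min(1,‖y‖²) ‖y‖^{-p}`, as a function of the norm. -/
noncomputable def truncKernel (p x : ℝ) : ℝ := min 1 (x ^ 2) * x ^ (-p)

theorem truncKernel_nonneg (p : ℝ) {x : ℝ} (hx : 0 ≤ x) : 0 ≤ truncKernel p x :=
  mul_nonneg (le_min zero_le_one (sq_nonneg _)) (Real.rpow_nonneg hx _)

theorem integrable_truncKernel (d : ℕ) (hd : 1 ≤ d) {α : ℝ} (hα0 : 0 < α) (hα2 : α < 2) :
    Integrable fun y : Vel d => truncKernel ((d : ℝ) + α) ‖y‖ := by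
  have : Nonempty (Fin d) := ⟨⟨0, hd⟩⟩
  rw [integrable_fun_norm_addHaar (volume : Measure (Vel d)) (f := truncKernel ((d : ℝ) + α)),
    ← Set.Ioc_union_Ioi_eq_Ioi zero_le_one]
  have hcast : ((d - 1 : ℕ) : ℝ) = (d : ℝ) - 1 := by
    rw [Nat.cast_sub hd, Nat.cast_one]
  refine IntegrableOn.union ?_ ?_
  · have h1 := intervalIntegral.intervalIntegrable_rpow' (a := 0) (b := 1) (r := 1 - α)
      (by linarith)
    rw [intervalIntegrable_iff_integrableOn_Ioc_of_le zero_le_one] at h1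
    refine h1.congr_fun (fun x hx => ?_) measurableSet_Ioc
    simp only [finrank_euclideanSpace_fin, smul_eq_mul, truncKernel]
    rw [min_eq_right (by nlinarith [hx.1, hx.2]), ← Real.rpow_natCast, hcast, ← Real.rpow_natCast,
      ← mul_assoc, ← Real.rpow_add hx.1, ← Real.rpow_add hx.1]
    congr 1
    push_cast
    ring
  · refine (integrableOn_Ioi_rpow_of_lt (a := -1 - α) (by linarith) one_pos).congr_fun
      (fun x hx => ?_) measurableSet_Ioi
    have hx1 : (1 : ℝ) < x := hx
    simp only [finrank_euclideanSpace_fin, smul_eq_mul, truncKernel]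
    rw [min_eq_left (by nlinarith), one_mul, ← Real.rpow_natCast, hcast,
      ← Real.rpow_add (one_pos.trans hx1)]
    congr 1
    ring

/-- The energy density of a Gaussian is bounded by an integrable function times the decay
`(1 + ‖w‖)^{-p}`. Far from `w` the kernel has this decay; near `w` the Gaussian does. -/
theorem exists_gaussian_energy_density_le (d : ℕ) {p : ℝ} (hp : 0 < p) :
    ∃ C : ℝ, 0 < C ∧ ∀ v w : Vel d,
      (Real.exp (-(‖v‖ ^ 2 / 8)) - Real.exp (-(‖w‖ ^ 2 / 8))) ^ 2 * ‖v - w‖ ^ (-p) ≤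
        C * (1 + ‖w‖) ^ (-p) * (truncKernel p ‖v - w‖ + Real.exp (-(‖v‖ ^ 2 / 4))) := by
  obtain ⟨C₁, hC₁, hexp⟩ := exists_rpow_mul_exp_neg_le (p + 4) (c := 3 / 8) (by norm_num)
  set e := Real.exp (3 / 4) with he
  refine ⟨4 ^ p + 16 * (e * C₁), by positivity, fun v w => ?_⟩
  set ρ := 1 + ‖w‖ with hρ
  have hw0 : 0 ≤ ‖w‖ := norm_nonneg w
  have hρ1 : 1 ≤ ρ := by linarith
  have hρ0 : 0 < ρ := by linarith
  set y := ‖v - w‖ with hy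
  have hy0 : 0 ≤ y := norm_nonneg _
  have hT : 0 ≤ truncKernel p y := truncKernel_nonneg p hy0
  have hγ : 0 < Real.exp (-(‖v‖ ^ 2 / 4)) := Real.exp_pos _
  have hyp : 0 ≤ y ^ (-p) := Real.rpow_nonneg hy0 _
  have hρp : 0 < ρ ^ (-p) := by positivity
  -- the Gaussian decay, with four powers to spare
  have hdecay : e * Real.exp (-(3 / 8 * ρ)) * ρ ^ 4 ≤ e * C₁ * ρ ^ (-p) := by
    have h1 : ρ ^ (-(p + 4)) * ρ ^ 4 = ρ ^ (-p) := by
      rw [← Real.rpow_natCast ρ 4, ← Real.rpow_add hρ0]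
      congr 1
      push_cast
      ring
    calc _ ≤ e * (C₁ * ρ ^ (-(p + 4))) * ρ ^ 4 := by
          gcongr
          exact hexp ρ hρ1
      _ = e * C₁ * (ρ ^ (-(p + 4)) * ρ ^ 4) := by ring
      _ = _ := by rw [h1]
  have hsquare : ∀ x : ℝ, (Real.exp (-(x / 8))) ^ 2 = Real.exp (-(x / 4)) := by
    intro x
    rw [← Real.exp_nat_mul]
    congr 1
    push_cast
    ring
  have hb : 3 / 16 * ρ - 3 / 8 ≤ ‖w‖ ^ 2 / 8 := by nlinarith [sq_nonneg (‖w‖ - 1)]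
  have hm2 : (Real.exp (-(3 / 16 * ρ - 3 / 8))) ^ 2 = e * Real.exp (-(3 / 8 * ρ)) := by
    rw [he, ← Real.exp_nat_mul, ← Real.exp_add]
    congr 1
    push_cast
    ring
  rcases le_or_gt (ρ / 4) y with hfar | hnear
  · have hy' : 0 < y := lt_of_lt_of_le (by positivity) hfar
    have h1 : y ^ (-p) ≤ 4 ^ p * ρ ^ (-p) := by
      calc y ^ (-p) ≤ (ρ / 4) ^ (-p) :=
            Real.rpow_le_rpow_of_nonpos (by positivity) hfar (by linarith)
        _ = _ := by
            rw [Real.div_rpow hρ0.le (by norm_num), Real.rpow_neg (by norm_num : (0 : ℝ) ≤ 4),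
              div_inv_eq_mul, mul_comm]
    have h2 : y ^ (-p) ≤ 16 * truncKernel p y := by
      have h3 : 1 / 16 ≤ min 1 (y ^ 2) := by
        apply le_min (by norm_num)
        nlinarith
      unfold truncKernel
      nlinarith
    have h4 : (Real.exp (-(‖w‖ ^ 2 / 8))) ^ 2 ≤ e * C₁ * ρ ^ (-p) := by
      refine le_trans ?_ hdecay
      rw [← hm2]
      calc _ ≤ (Real.exp (-(3 / 16 * ρ - 3 / 8))) ^ 2 := by gcongr
        _ ≤ _ := le_mul_of_one_le_right (by positivity) (one_le_pow₀ hρ1)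
    have h5 : (Real.exp (-(‖v‖ ^ 2 / 8)) - Real.exp (-(‖w‖ ^ 2 / 8))) ^ 2 ≤
        Real.exp (-(‖v‖ ^ 2 / 4)) + (Real.exp (-(‖w‖ ^ 2 / 8))) ^ 2 := by
      rw [← hsquare]
      nlinarith [Real.exp_pos (-(‖v‖ ^ 2 / 8)), Real.exp_pos (-(‖w‖ ^ 2 / 8)),
        mul_pos (Real.exp_pos (-(‖v‖ ^ 2 / 8))) (Real.exp_pos (-(‖w‖ ^ 2 / 8)))]
    calc _ ≤ (Real.exp (-(‖v‖ ^ 2 / 4)) + (Real.exp (-(‖w‖ ^ 2 / 8))) ^ 2) * y ^ (-p) := by gcongr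
      _ = Real.exp (-(‖v‖ ^ 2 / 4)) * y ^ (-p) + (Real.exp (-(‖w‖ ^ 2 / 8))) ^ 2 * y ^ (-p) := by
          ring
      _ ≤ Real.exp (-(‖v‖ ^ 2 / 4)) * (4 ^ p * ρ ^ (-p)) +
          (e * C₁ * ρ ^ (-p)) * (16 * truncKernel p y) := by gcongr
      _ ≤ _ := by
          have h6 : 0 ≤ 16 * (e * C₁) * ρ ^ (-p) * Real.exp (-(‖v‖ ^ 2 / 4)) := by positivity
          have h7 : 0 ≤ 4 ^ p * ρ ^ (-p) * truncKernel p y := by positivity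
          linarith
  · have hv1 : ‖v‖ ≤ ‖w‖ + y := by
      linarith [norm_le_norm_add_norm_sub' v w]
    have hv2 : ‖w‖ - y ≤ ‖v‖ := by
      linarith [norm_le_norm_add_norm_sub v w]
    have ha : 3 / 16 * ρ - 3 / 8 ≤ ‖v‖ ^ 2 / 8 := by nlinarith [sq_nonneg (‖v‖ - 1)]
    have h1 := abs_exp_neg_sub_exp_neg_le ha hb
    have h2 : |‖v‖ ^ 2 / 8 - ‖w‖ ^ 2 / 8| ≤ y * ρ := by
      have h3 : |‖v‖ - ‖w‖| ≤ y := abs_norm_sub_norm_le v w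
      have h4 : ‖v‖ ^ 2 / 8 - ‖w‖ ^ 2 / 8 = (‖v‖ - ‖w‖) * ((‖v‖ + ‖w‖) / 8) := by ring
      rw [h4, abs_mul, abs_of_nonneg (by positivity : 0 ≤ (‖v‖ + ‖w‖) / 8)]
      gcongr
      linarith
    have h5 : (Real.exp (-(‖v‖ ^ 2 / 8)) - Real.exp (-(‖w‖ ^ 2 / 8))) ^ 2 ≤
        e * Real.exp (-(3 / 8 * ρ)) * ρ ^ 2 * y ^ 2 := by
      rw [← sq_abs, ← hm2]
      calc _ ≤ (Real.exp (-(3 / 16 * ρ - 3 / 8)) * (y * ρ)) ^ 2 := by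
            gcongr
            exact h1.trans (by gcongr)
        _ = _ := by ring
    have h6 : y ^ 2 ≤ ρ ^ 2 * min 1 (y ^ 2) := by
      rw [mul_min_of_nonneg _ _ (sq_nonneg ρ)]
      apply le_min
      · nlinarith
      · nlinarith [sq_nonneg y]
    calc _ ≤ e * Real.exp (-(3 / 8 * ρ)) * ρ ^ 2 * y ^ 2 * y ^ (-p) := by gcongr
      _ ≤ e * Real.exp (-(3 / 8 * ρ)) * ρ ^ 2 * (ρ ^ 2 * min 1 (y ^ 2)) * y ^ (-p) := by gcongr
      _ = e * Real.exp (-(3 / 8 * ρ)) * ρ ^ 4 * truncKernel p y := by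
          unfold truncKernel; ring
      _ ≤ e * C₁ * ρ ^ (-p) * truncKernel p y := by gcongr
      _ ≤ _ := by
          have h7 : 0 ≤ 4 ^ p * ρ ^ (-p) * truncKernel p y := by positivity
          have h8 : 0 ≤ e * C₁ * ρ ^ (-p) * truncKernel p y := by positivity
          have h9 : 0 ≤ (4 ^ p + 16 * (e * C₁)) * ρ ^ (-p) * Real.exp (-(‖v‖ ^ 2 / 4)) := by
            positivity
          linarith

theorem lintegral_comp_inv_smul {d : ℕ} {F : Vel d → ℝ≥0∞} (hF : Measurable F) {r : ℝ}
    (hr : 0 < r) : ∫⁻ v, F (r⁻¹ • v) = ENNReal.ofReal (r ^ d) * ∫⁻ v, F v := by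
  rw [← lintegral_map (f := F) (g := fun v : Vel d => r⁻¹ • v) hF (by fun_prop),
    Measure.map_addHaar_smul _ (inv_ne_zero hr.ne'), lintegral_smul_measure,
    finrank_euclideanSpace_fin, smul_eq_mul, inv_pow, inv_inv, abs_of_pos (by positivity)]

theorem sqrt_heat {d : ℕ} {t : ℝ} (ht : 0 < t) (v : Vel d) :
    √(heat t v) = (4 * Real.pi) ^ (-((d : ℝ) / 4)) * (√t) ^ (-((d : ℝ) / 2)) *
      Real.exp (-(‖(√t)⁻¹ • v‖ ^ 2 / 8)) := by
  have hr : 0 < √t := Real.sqrt_pos.2 ht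
  have h1 : (‖(√t)⁻¹ • v‖ ^ 2 : ℝ) = ‖v‖ ^ 2 / t := by
    rw [norm_smul, norm_inv, Real.norm_of_nonneg hr.le, mul_pow, inv_pow, Real.sq_sqrt ht.le]
    ring
  rw [h1, Real.sqrt_eq_iff_mul_self_eq (heat_pos ht v).le (by positivity), heat,
    Real.mul_rpow (by positivity) ht.le]
  have h2 : (4 * Real.pi) ^ (-((d : ℝ) / 2)) =
      (4 * Real.pi) ^ (-((d : ℝ) / 4)) * (4 * Real.pi) ^ (-((d : ℝ) / 4)) := by
    rw [← Real.rpow_add (by positivity)]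
    congr 1
    ring
  have h3 : t ^ (-((d : ℝ) / 2)) = (√t) ^ (-((d : ℝ) / 2)) * (√t) ^ (-((d : ℝ) / 2)) := by
    rw [← Real.mul_rpow hr.le hr.le, Real.mul_self_sqrt ht.le]
  have h4 : Real.exp (-(‖v‖ ^ 2 / (4 * t))) =
      Real.exp (-(‖v‖ ^ 2 / t / 8)) * Real.exp (-(‖v‖ ^ 2 / t / 8)) := by
    rw [← Real.exp_add]
    congr 1
    field_simp
    ring
  rw [h2, h3, h4]
  ring

/-- The energy of a heat kernel has the decay of the kernel, uniformly in time. -/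
theorem exists_sqrtEnergy_heat_le (d : ℕ) (hd : 1 ≤ d) {α : ℝ} (hα0 : 0 < α) (hα2 : α < 2) :
    ∃ C : ℝ, 0 < C ∧ ∀ t, 0 < t → ∀ w : Vel d,
      sqrtEnergy ((d : ℝ) + α) (heat t) w ≤
        ENNReal.ofReal (C * (√t + ‖w‖) ^ (-((d : ℝ) + α))) := by
  set p := (d : ℝ) + α with hp
  have hp0 : 0 < p := by positivity
  obtain ⟨C₀, hC₀, hdens⟩ := exists_gaussian_energy_density_le d hp0
  have hK := integrable_truncKernel d hd hα0 hα2
  rw [← hp] at hK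
  have hG : Integrable fun v : Vel d => Real.exp (-(‖v‖ ^ 2 / 4)) := by
    refine (integrable_exp_neg_norm_rpow d hd (κ := 1 / 4) (α := 2) (by norm_num)
      two_pos).congr (.of_forall fun v => ?_)
    simp only [Real.rpow_two]
    ring_nf
  set I := (∫ y : Vel d, truncKernel p ‖y‖) + ∫ v : Vel d, Real.exp (-(‖v‖ ^ 2 / 4)) with hI
  have hI0 : 0 ≤ I := add_nonneg (integral_nonneg fun y => truncKernel_nonneg p (norm_nonneg y))
    (integral_nonneg fun v => (Real.exp_pos _).le)
  have hunit : ∀ w : Vel d, ∫⁻ v : Vel d, ENNReal.ofReal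
      ((Real.exp (-(‖v‖ ^ 2 / 8)) - Real.exp (-(‖w‖ ^ 2 / 8))) ^ 2 * ‖v - w‖ ^ (-p)) ≤
      ENNReal.ofReal (C₀ * (1 + ‖w‖) ^ (-p) * I) := by
    intro w
    have hsum : Integrable fun v : Vel d =>
        truncKernel p ‖v - w‖ + Real.exp (-(‖v‖ ^ 2 / 4)) := (hK.comp_sub_right w).add hG
    have hIw : ∫ v : Vel d, (truncKernel p ‖v - w‖ + Real.exp (-(‖v‖ ^ 2 / 4))) = I := by
      rw [integral_add (hK.comp_sub_right w) hG,
        integral_sub_right_eq_self (fun y : Vel d => truncKernel p ‖y‖) w]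
    rw [← hIw, ← integral_const_mul, ofReal_integral_eq_lintegral_ofReal (hsum.const_mul _)]
    · exact lintegral_mono fun v => ENNReal.ofReal_le_ofReal (hdens v w)
    · refine .of_forall fun v => mul_nonneg (by positivity) (add_nonneg
        (truncKernel_nonneg p (norm_nonneg _)) (Real.exp_pos _).le)
  set c := (4 * Real.pi) ^ (-((d : ℝ) / 4)) with hc
  refine ⟨c ^ 2 * C₀ * (I + 1), by positivity, fun t ht w => ?_⟩
  set r := √t with hr
  have hr0 : 0 < r := Real.sqrt_pos.2 ht
  have hscale : ∀ v : Vel d, (√(heat t v) - √(heat t w)) ^ 2 * ‖v - w‖ ^ (-p) =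
      c ^ 2 * r ^ (-(d : ℝ)) * r ^ (-p) *
        ((Real.exp (-(‖r⁻¹ • v‖ ^ 2 / 8)) - Real.exp (-(‖r⁻¹ • w‖ ^ 2 / 8))) ^ 2 *
          ‖r⁻¹ • v - r⁻¹ • w‖ ^ (-p)) := by
    intro v
    have h1 : r ^ (-p) * ‖r⁻¹ • v - r⁻¹ • w‖ ^ (-p) = ‖v - w‖ ^ (-p) := by
      rw [← smul_sub, norm_smul, norm_inv, Real.norm_of_nonneg hr0.le,
        ← Real.mul_rpow hr0.le (by positivity), mul_inv_cancel_left₀ hr0.ne']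
    have h2 : r ^ (-(d : ℝ)) = r ^ (-((d : ℝ) / 2)) * r ^ (-((d : ℝ) / 2)) := by
      rw [← Real.rpow_add hr0]
      congr 1
      ring
    rw [sqrt_heat ht, sqrt_heat ht, ← h1, h2]
    ring
  have hmeas : Measurable fun v : Vel d => ENNReal.ofReal
      ((Real.exp (-(‖v‖ ^ 2 / 8)) - Real.exp (-(‖r⁻¹ • w‖ ^ 2 / 8))) ^ 2 *
        ‖v - r⁻¹ • w‖ ^ (-p)) := by fun_prop
  unfold sqrtEnergy
  simp_rw [hscale]
  have hcr : 0 ≤ c ^ 2 * r ^ (-(d : ℝ)) * r ^ (-p) := by positivity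
  simp_rw [ENNReal.ofReal_mul hcr]
  rw [lintegral_const_mul' _ _ ENNReal.ofReal_ne_top, lintegral_comp_inv_smul hmeas hr0]
  calc _ ≤ ENNReal.ofReal (c ^ 2 * r ^ (-(d : ℝ)) * r ^ (-p)) * (ENNReal.ofReal (r ^ d) *
          ENNReal.ofReal (C₀ * (1 + ‖r⁻¹ • w‖) ^ (-p) * I)) := by
        gcongr
        exact hunit _
    _ = ENNReal.ofReal (c ^ 2 * C₀ * I * (r + ‖w‖) ^ (-p)) := by
        rw [← ENNReal.ofReal_mul (by positivity), ← ENNReal.ofReal_mul (by positivity)]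
        congr 1
        have h1 : r ^ (-(d : ℝ)) * r ^ d = 1 := by
          rw [← Real.rpow_natCast r d, ← Real.rpow_add hr0, neg_add_cancel, Real.rpow_zero]
        have h2 : r ^ (-p) * (1 + ‖r⁻¹ • w‖) ^ (-p) = (r + ‖w‖) ^ (-p) := by
          rw [← Real.mul_rpow hr0.le (by positivity), norm_smul, norm_inv,
            Real.norm_of_nonneg hr0.le, mul_add, mul_one, mul_inv_cancel_left₀ hr0.ne']
        rw [← h2]
        linear_combination (c ^ 2 * r ^ (-p) * C₀ * (1 + ‖r⁻¹ • w‖) ^ (-p) * I) * h1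
    _ ≤ _ := by
        apply ENNReal.ofReal_le_ofReal
        gcongr
        linarith

/-! ### The energy of the square root of the equilibrium -/

/-- The function `(a, b) ↦ (√a - √b)²` is convex and homogeneous of degree one, hence it satisfies
Jensen's inequality for an arbitrary measure. The Cauchy–Schwarz inequality gives a direct proof. -/
theorem ofReal_sqrt_integral_sub_sq_le {η : Measure ℝ} {a b : ℝ → ℝ} (ha : Integrable a η)
    (hb : Integrable b η) (ha0 : ∀ᵐ t ∂η, 0 ≤ a t) (hb0 : ∀ᵐ t ∂η, 0 ≤ b t) :
    ENNReal.ofReal ((√(∫ t, a t ∂η) - √(∫ t, b t ∂η)) ^ 2) ≤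
      ∫⁻ t, ENNReal.ofReal ((√(a t) - √(b t)) ^ 2) ∂η := by
  have hA0 : 0 ≤ ∫ t, a t ∂η := integral_nonneg_of_ae ha0
  have hB0 : 0 ≤ ∫ t, b t ∂η := integral_nonneg_of_ae hb0
  have hmem : ∀ {f : ℝ → ℝ}, Integrable f η → (∀ᵐ t ∂η, 0 ≤ f t) →
      MemLp (fun t => √(f t)) 2 η := by
    intro f hf hf0
    rw [memLp_two_iff_integrable_sq
      (Real.continuous_sqrt.comp_aestronglyMeasurable hf.aestronglyMeasurable)]
    refine hf.congr ?_
    filter_upwards [hf0] with t ht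
    rw [Real.sq_sqrt ht]
  have hab : Integrable (fun t => √(a t) * √(b t)) η := (hmem ha ha0).integrable_mul (hmem hb hb0)
  have hcs : ∫ t, √(a t) * √(b t) ∂η ≤ √(∫ t, a t ∂η) * √(∫ t, b t ∂η) := by
    have h := integral_mul_le_Lp_mul_Lq_of_nonneg (p := 2) (q := 2) Real.HolderConjugate.two_two
      (μ := η) (.of_forall fun t => Real.sqrt_nonneg (a t))
      (.of_forall fun t => Real.sqrt_nonneg (b t))
      (by simpa using hmem ha ha0) (by simpa using hmem hb hb0)
    have e1 : ∫ t, √(a t) ^ (2 : ℝ) ∂η = ∫ t, a t ∂η := by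
      apply integral_congr_ae
      filter_upwards [ha0] with t ht
      rw [Real.rpow_two, Real.sq_sqrt ht]
    have e2 : ∫ t, √(b t) ^ (2 : ℝ) ∂η = ∫ t, b t ∂η := by
      apply integral_congr_ae
      filter_upwards [hb0] with t ht
      rw [Real.rpow_two, Real.sq_sqrt ht]
    rwa [e1, e2, ← Real.sqrt_eq_rpow, ← Real.sqrt_eq_rpow] at h
  have hsum : Integrable (fun t => a t + b t - 2 * (√(a t) * √(b t))) η :=
    (ha.add hb).sub (hab.const_mul 2)
  have hexpand : ∀ᵐ t ∂η, a t + b t - 2 * (√(a t) * √(b t)) = (√(a t) - √(b t)) ^ 2 := by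
    filter_upwards [ha0, hb0] with t h1 h2
    rw [sub_sq, Real.sq_sqrt h1, Real.sq_sqrt h2]
    ring
  have hint : ∫ t, (√(a t) - √(b t)) ^ 2 ∂η =
      ∫ t, a t ∂η + ∫ t, b t ∂η - 2 * ∫ t, √(a t) * √(b t) ∂η := by
    have hadd : Integrable (fun t => a t + b t) η := ha.add hb
    rw [← integral_congr_ae hexpand, integral_sub hadd (hab.const_mul 2), integral_add ha hb,
      integral_const_mul]
  rw [← ofReal_integral_eq_lintegral_ofReal (hsum.congr hexpand)
    (.of_forall fun t => sq_nonneg _)]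
  apply ENNReal.ofReal_le_ofReal
  rw [hint, sub_sq, Real.sq_sqrt hA0, Real.sq_sqrt hB0]
  linarith

theorem measurable_heatMixture {d : ℕ} (η : Measure ℝ) [SFinite η] :
    Measurable (heatMixture η : Vel d → ℝ) := by
  have h : StronglyMeasurable (Function.uncurry fun (v : Vel d) (t : ℝ) => heat t v) :=
    (measurable_heat.comp measurable_swap).stronglyMeasurable
  exact h.integral_prod_right.measurable

/-- A form of Fatou's lemma for sequences that converge pointwise. -/
theorem lintegral_le_of_tendsto_of_le {X : Type*} [MeasurableSpace X] {μ : Measure X}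
    {F : ℕ → X → ℝ≥0∞} {G : X → ℝ≥0∞} {B : ℝ≥0∞} (hF : ∀ n, Measurable (F n))
    (hlim : ∀ x, Tendsto (fun n => F n x) atTop (𝓝 (G x))) (hB : ∀ n, ∫⁻ x, F n x ∂μ ≤ B) :
    ∫⁻ x, G x ∂μ ≤ B := by
  calc ∫⁻ x, G x ∂μ = ∫⁻ x, liminf (fun n => F n x) atTop ∂μ :=
        lintegral_congr fun x => (hlim x).liminf_eq.symm
    _ ≤ liminf (fun n => ∫⁻ x, F n x ∂μ) atTop := lintegral_liminf_le hF
    _ ≤ B := liminf_le_of_frequently_le' (.of_forall hB)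

theorem lintegral_heat {d : ℕ} {t : ℝ} (ht : 0 < t) :
    ∫⁻ v : Vel d, ENNReal.ofReal (heat t v) = 1 := by
  have hb : 0 < (4 * t)⁻¹ := by positivity
  have h := GaussianFourier.integral_rexp_neg_mul_sq_norm (V := Vel d) hb
  have h1 : ∀ v : Vel d, heat t v =
      (4 * Real.pi * t) ^ (-((d : ℝ) / 2)) * Real.exp (-(4 * t)⁻¹ * ‖v‖ ^ 2) := by
    intro v
    rw [heat]
    congr 2
    ring
  have h2 : ∫ v : Vel d, heat t v = 1 := by
    simp_rw [h1]
    rw [integral_const_mul, h, finrank_euclideanSpace_fin, Real.rpow_neg (by positivity),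
      show Real.pi / (4 * t)⁻¹ = 4 * Real.pi * t by field_simp]
    exact inv_mul_cancel₀ (by positivity)
  rw [← ofReal_integral_eq_lintegral_ofReal (.of_integral_ne_zero (by rw [h2]; exact one_ne_zero))
    (.of_forall fun v => (heat_pos ht v).le), h2, ENNReal.ofReal_one]

namespace IsStableApprox

variable {β κ : ℝ} {η : ℕ → Measure ℝ}

theorem lintegral_heatMixture_le {d : ℕ} (hd : 1 ≤ d) (h : IsStableApprox β κ η) (hβ : 0 < β)
    (hκ : 0 < κ) (n : ℕ) : ∫⁻ v : Vel d, ENNReal.ofReal (heatMixture (η n) v) ≤ 1 := by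
  have := h.sFinite n
  calc ∫⁻ v : Vel d, ENNReal.ofReal (heatMixture (η n) v)
      = ∫⁻ v : Vel d, ∫⁻ t, ENNReal.ofReal (heat t v) ∂(η n) := by
        refine lintegral_congr fun v => ?_
        rw [heatMixture, ofReal_integral_eq_lintegral_ofReal (h.integrable_heat hd hβ hκ n v)]
        filter_upwards [h.ae_pos n] with t ht using (heat_pos ht v).le
    _ = ∫⁻ t, (∫⁻ v : Vel d, ENNReal.ofReal (heat t v)) ∂(η n) := by
        apply lintegral_lintegral_swap
        exact (measurable_heat.comp measurable_swap).ennreal_ofReal.aemeasurable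
    _ = ∫⁻ t, 1 ∂(η n) := by
        apply lintegral_congr_ae
        filter_upwards [h.ae_pos n] with t ht using lintegral_heat ht
    _ ≤ 1 := by
        rw [lintegral_one]
        exact h.measure_univ_le_one hβ n

/-- The energy of a superposition is at most the superposition of the energies. -/
theorem sqrtEnergy_heatMixture_le {d : ℕ} (hd : 1 ≤ d) (h : IsStableApprox β κ η) (hβ : 0 < β)
    (hκ : 0 < κ) (n : ℕ) (p : ℝ) (w : Vel d) :
    sqrtEnergy p (heatMixture (η n)) w ≤ ∫⁻ t, sqrtEnergy p (heat t) w ∂(η n) := by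
  have := h.sFinite n
  unfold sqrtEnergy
  rw [lintegral_lintegral_swap]
  · refine lintegral_mono fun v => ?_
    have hk : 0 ≤ ‖v - w‖ ^ (-p) := Real.rpow_nonneg (norm_nonneg _) _
    have hpos : ∀ x : Vel d, ∀ᵐ t ∂(η n), 0 ≤ heat t x := by
      intro x
      filter_upwards [h.ae_pos n] with t ht using (heat_pos ht x).le
    have h1 := ofReal_sqrt_integral_sub_sq_le (h.integrable_heat hd hβ hκ n v)
      (h.integrable_heat hd hβ hκ n w) (hpos v) (hpos w)
    simp only [ENNReal.ofReal_mul (sq_nonneg _)]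
    rw [lintegral_mul_const' _ _ ENNReal.ofReal_ne_top]
    gcongr
    exact h1
  · have hm1 : Measurable fun z : ℝ × Vel d => heat z.1 w :=
      measurable_heat.comp (measurable_fst.prodMk measurable_const)
    have hm := measurable_heat (d := d)
    apply Measurable.aemeasurable
    unfold Function.uncurry
    fun_prop

end IsStableApprox

/-- The estimates for heat kernels pass to the limit: the energy of `√u` is controlled by the moment
of the mixing measures near the origin and by the decay of the kernel away from it, and both are
comparable with the lower bound of `u`. -/
theorem exists_unnormalizedEquilibrium_bounds (d : ℕ) (hd : 1 ≤ d) {α : ℝ} (hα0 : 0 < α)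
    (hα2 : α < 2) :
    Measurable (unnormalizedEquilibrium α : Vel d → ℝ) ∧
    (∀ v : Vel d, 0 < unnormalizedEquilibrium α v) ∧
    ∫⁻ v : Vel d, ENNReal.ofReal (unnormalizedEquilibrium α v) ≤ 1 ∧
    ∃ C : ℝ, 0 < C ∧ ∀ w : Vel d,
      sqrtEnergy ((d : ℝ) + α) (unnormalizedEquilibrium α) w ≤
        ENNReal.ofReal (C * unnormalizedEquilibrium α w) := by
  have hβ0 : 0 < α / 2 := by positivity
  have hβ1 : α / 2 < 1 := by linarith
  have hκ : 0 < α⁻¹ := by positivity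
  obtain ⟨η, hη⟩ := exists_isStableApprox hβ0 hβ1 hκ
  have hlim := fun v : Vel d => hη.tendsto_unnormalizedEquilibrium hd hα0 v
  have hmeasmix : ∀ n, Measurable (heatMixture (η n) : Vel d → ℝ) := fun n =>
    have := hη.sFinite n
    measurable_heatMixture _
  obtain ⟨c, R, hc, hR, hlow⟩ := exists_le_unnormalizedEquilibrium d hd hα0 hα2
  have hR0 : 0 < R := one_pos.trans_le hR
  set p := (d : ℝ) + α with hp
  have hp0 : 0 < p := by positivity
  refine ⟨measurable_of_tendsto_metrizable hmeasmix (tendsto_pi_nhds.2 hlim), fun v => ?_, ?_, ?_⟩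
  · have hr : 0 < max R ‖v‖ := hR0.trans_le (le_max_left _ _)
    exact lt_of_lt_of_le (by positivity) (hlow _ (le_max_left _ _) v (le_max_right _ _))
  · exact lintegral_le_of_tendsto_of_le (fun n => (hmeasmix n).ennreal_ofReal)
      (fun v => (ENNReal.continuous_ofReal.tendsto _).comp (hlim v))
      (fun n => hη.lintegral_heatMixture_le hd hβ0 hκ n)
  · obtain ⟨C₁, hC₁, henergy⟩ := exists_sqrtEnergy_heat_le d hd hα0 hα2
    rw [← hp] at henergy
    obtain ⟨M, hM, hmom⟩ := hη.exists_lintegral_rpow_neg_le hβ0 hκ (q := p / 2) (by positivity)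
    have hfatou : ∀ (w : Vel d) (B : ℝ≥0∞), (∀ n, ∫⁻ t, sqrtEnergy p (heat t) w ∂(η n) ≤ B) →
        sqrtEnergy p (unnormalizedEquilibrium α) w ≤ B := by
      intro w B hB
      refine lintegral_le_of_tendsto_of_le (F := fun n v => ENNReal.ofReal
        ((√(heatMixture (η n) v) - √(heatMixture (η n) w)) ^ 2 * ‖v - w‖ ^ (-p)))
        (fun n => ?_) (fun v => ?_)
        (fun n => (hη.sqrtEnergy_heatMixture_le hd hβ0 hκ n p w).trans (hB n))
      · have := hmeasmix n
        fun_prop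
      · refine (ENNReal.continuous_ofReal.tendsto _).comp (Tendsto.mul_const _ ?_)
        exact (((Real.continuous_sqrt.tendsto _).comp (hlim v)).sub
          ((Real.continuous_sqrt.tendsto _).comp (hlim w))).pow 2
    refine ⟨max (C₁ * M * R ^ p) C₁ / c, by positivity, fun w => ?_⟩
    rcases le_or_gt ‖w‖ R with hw | hw
    · refine hfatou w _ fun n => ?_
      have h1 : C₁ * M ≤ max (C₁ * M * R ^ p) C₁ / c * unnormalizedEquilibrium α w := by
        have h2 := hlow R le_rfl w hw
        have h3 : R ^ p * R ^ (-p) = 1 := by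
          rw [← Real.rpow_add hR0, add_neg_cancel, Real.rpow_zero]
        calc C₁ * M = C₁ * M * R ^ p / c * (c * R ^ (-p)) := by
              rw [div_mul_eq_mul_div, eq_div_iff hc.ne']
              linear_combination (-(C₁ * M * c)) * h3
          _ ≤ max (C₁ * M * R ^ p) C₁ / c * unnormalizedEquilibrium α w := by
              gcongr
              exact le_max_left _ _
      calc ∫⁻ t, sqrtEnergy p (heat t) w ∂(η n)
          ≤ ∫⁻ t, ENNReal.ofReal C₁ * ENNReal.ofReal (t ^ (-(p / 2))) ∂(η n) := by
            apply lintegral_mono_ae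
            filter_upwards [hη.ae_pos n] with t ht
            refine (henergy t ht w).trans ?_
            rw [← ENNReal.ofReal_mul hC₁.le]
            apply ENNReal.ofReal_le_ofReal
            have ht' : 0 < √t := Real.sqrt_pos.2 ht
            have h4 : t ^ (-(p / 2)) = (√t) ^ (-p) := by
              rw [Real.sqrt_eq_rpow, ← Real.rpow_mul ht.le]
              congr 1
              ring
            rw [h4]
            gcongr C₁ * ?_
            exact Real.rpow_le_rpow_of_nonpos ht' (by linarith [norm_nonneg w]) (by linarith)
        _ ≤ ENNReal.ofReal C₁ * ENNReal.ofReal M := by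
            rw [lintegral_const_mul' _ _ ENNReal.ofReal_ne_top]
            gcongr
            exact hmom n
        _ ≤ _ := by
            rw [← ENNReal.ofReal_mul hC₁.le]
            exact ENNReal.ofReal_le_ofReal h1
    · have hw0 : 0 < ‖w‖ := hR0.trans hw
      refine hfatou w _ fun n => ?_
      have h1 : C₁ * ‖w‖ ^ (-p) ≤ max (C₁ * M * R ^ p) C₁ / c * unnormalizedEquilibrium α w := by
        have h2 := hlow ‖w‖ hw.le w le_rfl
        calc C₁ * ‖w‖ ^ (-p) = C₁ / c * (c * ‖w‖ ^ (-p)) := by field_simp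
          _ ≤ _ := by
              gcongr
              exact le_max_right _ _
      calc ∫⁻ t, sqrtEnergy p (heat t) w ∂(η n)
          ≤ ∫⁻ t, ENNReal.ofReal (C₁ * ‖w‖ ^ (-p)) ∂(η n) := by
            apply lintegral_mono_ae
            filter_upwards [hη.ae_pos n] with t ht
            refine (henergy t ht w).trans (ENNReal.ofReal_le_ofReal ?_)
            gcongr C₁ * ?_
            exact Real.rpow_le_rpow_of_nonpos hw0 (by linarith [Real.sqrt_nonneg t]) (by linarith)
        _ ≤ ENNReal.ofReal (C₁ * ‖w‖ ^ (-p)) := by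
            rw [lintegral_const]
            exact mul_le_of_le_one_right' (hη.measure_univ_le_one hβ0 n)
        _ ≤ _ := ENNReal.ofReal_le_ofReal h1

/-- The equilibrium is a positive measurable function, and the energy of its square root is
dominated by the equilibrium itself. -/
theorem exists_equilibrium_bounds (d : ℕ) (hd : 1 ≤ d) {α : ℝ} (hα0 : 0 < α) (hα2 : α < 2) :
    Measurable (equilibrium α : Vel d → ℝ) ∧ (∀ v : Vel d, 0 < equilibrium α v) ∧
    ∃ C : ℝ, 0 < C ∧ ∀ w : Vel d, sqrtEnergy ((d : ℝ) + α) (equilibrium α) w ≤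
      ENNReal.ofReal (C * equilibrium α w) := by
  obtain ⟨hm, hpos, hle, C, hC, hE⟩ := exists_unnormalizedEquilibrium_bounds d hd hα0 hα2
  have hint : Integrable (unnormalizedEquilibrium α : Vel d → ℝ) := by
    refine ⟨hm.aestronglyMeasurable, ?_⟩
    rw [hasFiniteIntegral_iff_ofReal (.of_forall fun v => (hpos v).le)]
    exact hle.trans_lt ENNReal.one_lt_top
  have hZ : 0 < ∫ w : Vel d, unnormalizedEquilibrium α w := by
    rw [integral_pos_iff_support_of_nonneg (fun v => (hpos v).le) hint]
    have : Function.support (unnormalizedEquilibrium α : Vel d → ℝ) = Set.univ :=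
      Set.eq_univ_of_forall fun v => (hpos v).ne'
    rw [this]
    exact isOpen_univ.measure_pos _ Set.univ_nonempty
  set Z := ∫ w : Vel d, unnormalizedEquilibrium α w with hZdef
  have hμ : ∀ v : Vel d, equilibrium α v = Z⁻¹ * unnormalizedEquilibrium α v := fun v => rfl
  have hZi : 0 < Z⁻¹ := inv_pos.2 hZ
  refine ⟨hm.const_mul _, fun v => mul_pos hZi (hpos v), C, hC, fun w => ?_⟩
  have h1 : sqrtEnergy ((d : ℝ) + α) (equilibrium α) w =
      ENNReal.ofReal Z⁻¹ * sqrtEnergy ((d : ℝ) + α) (unnormalizedEquilibrium α) w := by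
    unfold sqrtEnergy
    rw [← lintegral_const_mul' _ _ ENNReal.ofReal_ne_top]
    refine lintegral_congr fun v => ?_
    rw [hμ, hμ, Real.sqrt_mul hZi.le, Real.sqrt_mul hZi.le, ← mul_sub, mul_pow,
      Real.sq_sqrt hZi.le, mul_assoc, ENNReal.ofReal_mul hZi.le]
  rw [h1, hμ]
  calc _ ≤ ENNReal.ofReal Z⁻¹ * ENNReal.ofReal (C * unnormalizedEquilibrium α w) := by
        gcongr
        exact hE w
    _ = _ := by
        rw [← ENNReal.ofReal_mul hZi.le]
        congr 1
        ring

/-! ### The coercivity inequality -/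

/-- The number `-α / 2` lies strictly between the poles `-1` and `0` of the Gamma function. -/
theorem fracLapConst_pos (d : ℕ) {α : ℝ} (hα0 : 0 < α) (hα2 : α < 2) : 0 < fracLapConst d α := by
  have h1 : 0 < Real.Gamma (((d : ℝ) + α) / 2) := Real.Gamma_pos_of_pos (by positivity)
  have h2 : 0 < |Real.Gamma (-(α / 2))| := by
    refine abs_pos.2 (Real.Gamma_ne_zero fun m hm => ?_)
    have h3 : (m : ℝ) = α / 2 := by linarith
    have h4 : 0 < m := by
      have : (0 : ℝ) < m := by rw [h3]; positivity
      exact_mod_cast this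
    have h5 : m < 1 := by
      have : (m : ℝ) < 1 := by rw [h3]; linarith
      exact_mod_cast this
    omega
  unfold fracLapConst
  positivity

theorem rpow_neg_half_eq {x : ℝ} (hx : 0 < x) : x ^ (-(1 / 2) : ℝ) = x⁻¹ * √x := by
  rw [Real.sqrt_eq_rpow, ← Real.rpow_neg_one, ← Real.rpow_add hx]
  norm_num

/-- The product rule for increments: with `h = f / μ`, the increment of `f μ^{-1/2} = h √μ` splits
into the increment of `h` and that of `√μ`. -/
theorem increment_sq_le {d : ℕ} {α : ℝ} (hpos : ∀ v : Vel d, 0 < equilibrium α v) (f : Vel d → ℝ)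
    (v w : Vel d) :
    (f v * equilibrium α v ^ (-(1 / 2) : ℝ) - f w * equilibrium α w ^ (-(1 / 2) : ℝ)) ^ 2 *
        ‖v - w‖ ^ (-((d : ℝ) + α)) ≤
      2 * symFormIntegrand α f f v w +
        2 * ((f w * (equilibrium α w)⁻¹) ^ 2 *
          ((√(equilibrium α v) - √(equilibrium α w)) ^ 2 * ‖v - w‖ ^ (-((d : ℝ) + α)))) := by
  have hk : 0 ≤ ‖v - w‖ ^ (-((d : ℝ) + α)) := Real.rpow_nonneg (norm_nonneg _) _
  have h1 : symFormIntegrand α f f v w =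
      ((f v * (equilibrium α v)⁻¹ - f w * (equilibrium α w)⁻¹) * √(equilibrium α v)) ^ 2 *
        ‖v - w‖ ^ (-((d : ℝ) + α)) := by
    rw [symFormIntegrand, mul_pow, Real.sq_sqrt (hpos v).le, Real.rpow_neg (norm_nonneg _)]
    ring
  rw [h1, rpow_neg_half_eq (hpos v), rpow_neg_half_eq (hpos w)]
  set h := f v * (equilibrium α v)⁻¹
  set h' := f w * (equilibrium α w)⁻¹
  set m := √(equilibrium α v)
  set m' := √(equilibrium α w)
  have h2 : f v * ((equilibrium α v)⁻¹ * m) - f w * ((equilibrium α w)⁻¹ * m') =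
      (h - h') * m + h' * (m - m') := by ring
  have h3 : ((h - h') * m + h' * (m - m')) ^ 2 ≤
      2 * ((h - h') * m) ^ 2 + 2 * (h' ^ 2 * (m - m') ^ 2) := by
    nlinarith [sq_nonneg ((h - h') * m - h' * (m - m'))]
  rw [h2]
  calc _ ≤ (2 * ((h - h') * m) ^ 2 + 2 * (h' ^ 2 * (m - m') ^ 2)) *
        ‖v - w‖ ^ (-((d : ℝ) + α)) := by gcongr
    _ = _ := by ring

/-- The error term of the product rule is controlled by the `L²` norm. -/
theorem lintegral_error_le {d : ℕ} {α C : ℝ} (hm : Measurable (equilibrium α : Vel d → ℝ))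
    (hpos : ∀ v : Vel d, 0 < equilibrium α v) (hC : 0 < C)
    (hE : ∀ w : Vel d, sqrtEnergy ((d : ℝ) + α) (equilibrium α) w ≤
      ENNReal.ofReal (C * equilibrium α w)) {f : Vel d → ℝ} (hf : AEMeasurable f volume) :
    ∫⁻ v : Vel d, ∫⁻ w : Vel d, ENNReal.ofReal ((f w * (equilibrium α w)⁻¹) ^ 2 *
        ((√(equilibrium α v) - √(equilibrium α w)) ^ 2 * ‖v - w‖ ^ (-((d : ℝ) + α)))) ≤
      ENNReal.ofReal C *
        ∫⁻ w : Vel d, ENNReal.ofReal ((f w * equilibrium α w ^ (-(1 / 2) : ℝ)) ^ 2) := by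
  rw [lintegral_lintegral_swap, ← lintegral_const_mul' _ _ ENNReal.ofReal_ne_top]
  · refine lintegral_mono fun w => ?_
    simp only [ENNReal.ofReal_mul (sq_nonneg (f w * (equilibrium α w)⁻¹))]
    rw [lintegral_const_mul' _ _ ENNReal.ofReal_ne_top]
    calc _ ≤ ENNReal.ofReal ((f w * (equilibrium α w)⁻¹) ^ 2) *
          ENNReal.ofReal (C * equilibrium α w) := by
          gcongr
          exact hE w
      _ = _ := by
          rw [← ENNReal.ofReal_mul (sq_nonneg _), ← ENNReal.ofReal_mul hC.le,
            rpow_neg_half_eq (hpos w), mul_pow, mul_pow, mul_pow, Real.sq_sqrt (hpos w).le]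
          congr 1
          ring
  · have hf2 : AEMeasurable (fun z : Vel d × Vel d => f z.2) (volume.prod volume) := hf.comp_snd
    unfold Function.uncurry
    fun_prop

theorem memLp_of_memWeightedL2 {d : ℕ} {α : ℝ} (hm : Measurable (equilibrium α : Vel d → ℝ))
    (hpos : ∀ v : Vel d, 0 < equilibrium α v) {f : Vel d → ℝ}
    (hf : MemWeightedL2 (fun v => (equilibrium α v)⁻¹) f) :
    MemLp (fun v => f v * equilibrium α v ^ (-(1 / 2) : ℝ)) 2 volume := by
  rw [memLp_two_iff_integrable_sq]
  · refine hf.2.congr (.of_forall fun v => ?_)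
    simp only
    rw [rpow_neg_half_eq (hpos v), mul_pow, mul_pow, Real.sq_sqrt (hpos v).le, sq_abs]
    have := (hpos v).ne'
    field_simp
  · exact hf.1.mul (hm.pow_const _).aestronglyMeasurable

theorem eLpNorm_two_sq_eq_lintegral {d : ℕ} (g : Vel d → ℝ) :
    eLpNorm g 2 volume ^ 2 = ∫⁻ v, ENNReal.ofReal (g v ^ 2) := by
  have h := eLpNorm_nnreal_pow_eq_lintegral (f := g) (μ := (volume : Measure (Vel d)))
    (p := 2) (by simp)
  simp only [NNReal.coe_ofNat, ENNReal.coe_ofNat, ENNReal.rpow_ofNat] at h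
  rw [h]
  refine lintegral_congr fun v => ?_
  rw [← ofReal_norm, ← ENNReal.ofReal_pow (norm_nonneg _), Real.norm_eq_abs, sq_abs]

end LevyFokkerPlanck

open LevyFokkerPlanck

theorem mainTheorem5 (d : ℕ) (hd : 1 ≤ d) (α : ℝ) (hα0 : 0 < α) (hα2 : α < 2) :
    ∃ C_R C : ℝ, 0 < C_R ∧ 0 < C ∧
      ∀ f : LevyFokkerPlanck.Vel d → ℝ,
        LevyFokkerPlanck.MemWeightedL2 (fun v => (LevyFokkerPlanck.equilibrium α v)⁻¹) f →
          ENNReal.ofReal C_R⁻¹ *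
              LevyFokkerPlanck.homSobolevNormSq (α / 2)
                (fun v => f v * LevyFokkerPlanck.equilibrium α v ^ (-(1 / 2) : ℝ)) ≤
            LevyFokkerPlanck.dissipation α f +
              ENNReal.ofReal C *
                eLpNorm (fun v => f v * LevyFokkerPlanck.equilibrium α v ^ (-(1 / 2) : ℝ)) 2
                  volume ^ 2 := by
  obtain ⟨hm, hpos, C, hC, hE⟩ := exists_equilibrium_bounds d hd hα0 hα2
  obtain ⟨c, hc, hG⟩ := exists_homSobolevNormSq_le_gagliardo d hα0
  set a := fracLapConst d α / 2 with ha
  have ha0 : 0 < a := half_pos (fracLapConst_pos d hα0 hα2)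
  refine ⟨(a * c / 2)⁻¹, a * C, by positivity, by positivity, fun f hf => ?_⟩
  set g : Vel d → ℝ :=
    fun v => f v * equilibrium α v ^ (-(1 / 2) : ℝ) with hg
  have hfm : AEMeasurable f volume := hf.1.aemeasurable
  set D := ∫⁻ v : Vel d, ∫⁻ w : Vel d,
    ENNReal.ofReal (symFormIntegrand α f f v w) with hD
  set Er : Vel d → Vel d → ℝ≥0∞ := fun v w => ENNReal.ofReal
    ((f w * (equilibrium α w)⁻¹) ^ 2 *
      ((√(equilibrium α v) - √(equilibrium α w)) ^ 2 *
        ‖v - w‖ ^ (-((d : ℝ) + α)))) with hEr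
  have hErm : AEMeasurable (Function.uncurry Er) (volume.prod volume) := by
    have hf2 : AEMeasurable (fun z : Vel d × Vel d => f z.2)
      (volume.prod volume) := hfm.comp_snd
    rw [hEr]
    unfold Function.uncurry
    fun_prop
  have hErm₂ : AEMeasurable (fun v => ∫⁻ w, Er v w) volume := hErm.lintegral_prod_right'
  have hErm' : ∀ v, AEMeasurable (Er v) volume := by
    intro v
    rw [hEr]
    fun_prop
  have herr : ∫⁻ v, ∫⁻ w, Er v w ≤ ENNReal.ofReal C * eLpNorm g 2 volume ^ 2 := by
    rw [eLpNorm_two_sq_eq_lintegral]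
    exact lintegral_error_le hm hpos hC hE hfm
  have hsplit : ENNReal.ofReal c * homSobolevNormSq (α / 2) g ≤
      2 * D + 2 * (ENNReal.ofReal C * eLpNorm g 2 volume ^ 2) := by
    refine (hG g (memLp_of_memWeightedL2 hm hpos hf).ofReal).trans ?_
    calc _ ≤ ∫⁻ v, ∫⁻ w, (2 * ENNReal.ofReal (symFormIntegrand α f f v w) +
          2 * Er v w) := by
          refine lintegral_mono fun v => lintegral_mono fun w => ?_
          refine (ENNReal.ofReal_le_ofReal
            (increment_sq_le hpos f v w)).trans ?_
          refine ENNReal.ofReal_add_le.trans_eq ?_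
          rw [ENNReal.ofReal_mul zero_le_two, ENNReal.ofReal_mul zero_le_two, ENNReal.ofReal_ofNat]
      _ = 2 * D + 2 * ∫⁻ v, ∫⁻ w, Er v w := by
          have h1 : ∀ v, ∫⁻ w, (2 * ENNReal.ofReal
              (symFormIntegrand α f f v w) + 2 * Er v w) =
              2 * (∫⁻ w, ENNReal.ofReal (symFormIntegrand α f f v w)) +
                2 * ∫⁻ w, Er v w := by
            intro v
            rw [lintegral_add_right' _ ((hErm' v).const_mul 2),
              lintegral_const_mul' _ _ ENNReal.ofNat_ne_top,
              lintegral_const_mul' _ _ ENNReal.ofNat_ne_top]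
          simp_rw [h1]
          rw [lintegral_add_right' _ (hErm₂.const_mul 2),
            lintegral_const_mul' _ _ ENNReal.ofNat_ne_top,
            lintegral_const_mul' _ _ ENNReal.ofNat_ne_top]
      _ ≤ _ := by gcongr
  have hhalf : ENNReal.ofReal (a / 2) * 2 = ENNReal.ofReal a := by
    rw [← ENNReal.ofReal_ofNat, ← ENNReal.ofReal_mul (by positivity)]
    congr 1
    ring
  calc ENNReal.ofReal (a * c / 2)⁻¹⁻¹ * homSobolevNormSq (α / 2) g
      = ENNReal.ofReal (a / 2) *
          (ENNReal.ofReal c * homSobolevNormSq (α / 2) g) := by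
        rw [inv_inv, ← mul_assoc, ← ENNReal.ofReal_mul (by positivity)]
        congr 2
        ring
    _ ≤ ENNReal.ofReal (a / 2) * (2 * D + 2 * (ENNReal.ofReal C * eLpNorm g 2 volume ^ 2)) := by
        gcongr
    _ = ENNReal.ofReal a * D + ENNReal.ofReal (a * C) * eLpNorm g 2 volume ^ 2 := by
        rw [mul_add, ← mul_assoc, ← mul_assoc, hhalf, ENNReal.ofReal_mul ha0.le, mul_assoc]
    _ = _ := rfl
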